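/- Let $K\ge 2$, let $1\ge p_1>p_2\ge p_3\ge\cdots\ge p_K\ge 0$ with $p_2\neq 0$, let $\mu\in(0,1]$, $\lambda>0$, and let $N\ge 1$. A group of $N$ individuals faces $K$ arms; every pull of arm $k$ yields, independently of everything else, reward $1$ with probability $p_k$ and reward $0$ otherwise. Each individual has a memory $M\in\{0,1,\dots,K\}$, initially $0$ (no preference; $M=k\ge 1$ means that it prefers arm $k$), and an independent Poisson clock of rate $\lambda$. When the clock of an individual ticks, the individual chooses $c\in\{0,1,\dots,K\}$: if $M=0$, then with probability $\mu$ it sets $c$ to an arm drawn uniformly from $\{1,\dots,K\}$, and with probability $1-\mu$ it sets $c$ to the current memory of an individual drawn uniformly from the whole group (itself included); if $M\neq 0$, it sets $c$ to the current memory of an individual drawn uniformly from the whole group (itself included). If $c\ne 0$, it pulls arm $c$, and sets $M\gets c$ if the reward is $1$; otherwise $M$ is unchanged. All random choices are independent. Let $X^N(t)=(X^N_0(t),\dots,X^N_K(t))$, where $X^N_k(t)$ is the number of individuals whose memory is $k$ at time $t$, and let $$E^N=\Big\{\lim_{t\to\infty}X^N(t)=(0,N,0,\dots,0)\Big\}.$$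 Then for every $\delta\in(0,1]$, $$\mathbb P(E^N)\;\ge\; 1-\Big(\frac{p_1}{p_2}\Big)^{-(1-\delta)\frac{\mu p_1}{Ke}N}-\exp\Big(-\frac{\mu p_1}{Ke}\,\frac{\delta^2}{2}\,N\Big),$$ where $e$ is Euler's number. Moreover, almost surely on $E^N$ every individual learns the best option, that is, from some time on it pulls only arm $1$; and there are constants $C,c>0$, independent of $N$, such that for all $N\ge 1$ the probability that every individual learns the best option is at least $1-Ce^{-cN}$. -/

import Mathlib

open MeasureTheory ProbabilityTheory Filter Topology unitInterval

noncomputable section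

namespace SocialBandit

/-- A memory variable: `none` is "no preference yet" (memory state `0`),
`some k` is "prefers arm `k`". Arms are indexed by `Fin K`, so the first arm is `0`. -/
abbrev Memory (K : ℕ) : Type := Option (Fin K)

/-- The primitive randomness attached to one tick of one clock, in this order:
* the time elapsed since the previous tick of the same clock (or since time `0`);
* the coin deciding between uniform sampling (`true`) and social sampling (`false`),
  used only if the individual has no preference;
* the arm picked by uniform sampling;
* the peer picked by social sampling (possibly the individual itself);
* for every arm, the reward that it generates if it is the one pulled
  (`true` is reward 1, `false` is reward 0). -/
abbrev TickData (K N : ℕ) : Type := ℝ × Bool × Fin K × Fin N × (Fin K → Bool)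

/-- A sample point: the data of the `j`-th tick (`j = 0, 1, …`) of every individual `n`. -/
abbrev Sample (K N : ℕ) : Type := Fin N × ℕ → TickData K N

variable {K N : ℕ}

def gap (z : TickData K N) : ℝ := z.1
def explore (z : TickData K N) : Bool := z.2.1
def uniformArm (z : TickData K N) : Fin K := z.2.2.1
def peer (z : TickData K N) : Fin N := z.2.2.2.1
def reward (z : TickData K N) : Fin K → Bool := z.2.2.2.2

/-- The law of the data of a single tick: independent components, namely an exponential gap of
rate `lam`, a Bernoulli(`μ`) coin, a uniform arm, a uniform peer, Bernoulli(`p k`) rewards. -/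
def tickLaw (K N : ℕ) (lam : ℝ) (μ : I) (p : Fin K → I) : Measure (TickData K N) :=
  (expMeasure lam).prod <|
    (bernoulliMeasure true false μ).prod <|
      (uniformOn (Set.univ : Set (Fin K))).prod <|
        (uniformOn (Set.univ : Set (Fin N))).prod <|
          Measure.pi fun k => bernoulliMeasure true false (p k)

/-- The probability measure: the data of all ticks of all individuals are independent. In
particular the clocks are independent Poisson processes of rate `lam`. -/
def law (K N : ℕ) (lam : ℝ) (μ : I) (p : Fin K → I) : Measure (Sample K N) :=
  Measure.infinitePi fun _ => tickLaw K N lam μ p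

/-- The time of the `j`-th tick of the clock of individual `n`. -/
def tickTime (ω : Sample K N) (n : Fin N) (j : ℕ) : ℝ :=
  ∑ i ∈ Finset.range (j + 1), gap (ω (n, i))

/-- The arm chosen by individual `n` when its clock ticks, given the current memories `m`
of all the individuals (`none`: no arm is pulled). -/
def choose (m : Fin N → Memory K) (n : Fin N) (z : TickData K N) : Option (Fin K) :=
  match m n with
  | none => if explore z then some (uniformArm z) else m (peer z)
  | some _ => m (peer z)

/-- The memories after a tick of the clock of individual `n`: it adopts the arm that it has
pulled if the reward is 1, and nothing changes otherwise. -/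
def refine (m : Fin N → Memory K) (n : Fin N) (z : TickData K N) : Fin N → Memory K :=
  match choose m n z with
  | none => m
  | some k => if reward z k then Function.update m n (some k) else m

/-- If individual `n` has already ticked `c n` times, for every `n`, the individual whose clock
ticks next (the one of least index if several clocks tick at once, which has probability 0). -/
def nextTicker [NeZero N] (ω : Sample K N) (c : Fin N → ℕ) : Fin N :=
  (Finset.univ.filter fun n => ∀ n', tickTime ω n (c n) ≤ tickTime ω n' (c n')).min' <| by
    obtain ⟨n, -, hn⟩ := Finset.exists_min_image Finset.univ (fun n => tickTime ω n (c n))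
      ⟨0, Finset.mem_univ _⟩
    exact ⟨n, by simpa using hn⟩

/-- The memories of all individuals, and the number of ticks that each has had so far, after the
first `l` ticks of the whole group, in chronological order. All memories start at `none`. -/
def run [NeZero N] (ω : Sample K N) : ℕ → (Fin N → Memory K) × (Fin N → ℕ)
  | 0 => (fun _ => none, fun _ => 0)
  | l + 1 =>
    let m := (run ω l).1
    let c := (run ω l).2
    let n := nextTicker ω c
    (refine m n (ω (n, c n)), Function.update c n (c n + 1))

/-- The individual whose clock makes the `l`-th tick of the whole group (`l = 0, 1, …`). -/
def ticker [NeZero N] (ω : Sample K N) (l : ℕ) : Fin N := nextTicker ω (run ω l).2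

/-- The time of the `l`-th tick of the whole group. -/
def groupTickTime [NeZero N] (ω : Sample K N) (l : ℕ) : ℝ :=
  tickTime ω (ticker ω l) ((run ω l).2 (ticker ω l))

/-- The arm pulled at the `l`-th tick of the whole group (`none`: no arm). -/
def pulled [NeZero N] (ω : Sample K N) (l : ℕ) : Option (Fin K) :=
  choose (run ω l).1 (ticker ω l) (ω (ticker ω l, (run ω l).2 (ticker ω l)))

/-- The number of ticks of the whole group up to and including time `t` (almost surely finite). -/
def tickCount (ω : Sample K N) (t : ℝ) : ℕ :=
  ∑ n : Fin N, {j : ℕ | tickTime ω n j ≤ t}.ncard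

/-- The memories of all the individuals at time `t`. -/
def memoryAt [NeZero N] (ω : Sample K N) (t : ℝ) : Fin N → Memory K :=
  (run ω (tickCount ω t)).1

/-- The system state at time `t`: how many individuals are in each memory state. -/
def state [NeZero N] (ω : Sample K N) (t : ℝ) : Memory K → ℕ :=
  fun a => (Finset.univ.filter fun n => memoryAt ω t n = a).card

/-- The success event: as `t → ∞` the system state converges to the one where all `N`
individuals have arm `b` in memory. -/
def absorbedAt (N : ℕ) [NeZero N] (b : Fin K) : Set (Sample K N) :=
  {ω | Tendsto (fun t : ℝ => state ω t) atTop (𝓝 (Pi.single (some b) N))}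

/-- Every individual learns arm `b`: from some time on, it pulls arm `b` at all its ticks. -/
def everyoneLearns (N : ℕ) [NeZero N] (b : Fin K) : Set (Sample K N) :=
  {ω | ∀ n : Fin N, ∃ t₀ : ℝ, ∀ l : ℕ,
    t₀ < groupTickTime ω l → ticker ω l = n → pulled ω l = some b}

end SocialBandit

end

/-! Write `b` for the best arm, `s` for the second largest success probability, `r = s / p b < 1`,
and `W = r ^ #{individuals preferring b}` (`weight`).

At a tick `W` does not increase on average. An individual without preference can only leave `W`
unchanged or lower it. If an individual preferring `b` consults one preferring another arm, `W`
gains on average at most `(p b - s) * W`; in the mirrored encounter it loses exactly that much.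
Ticker and peer are uniform, so the two encounters are equally likely and cancel
(`integral_weight_adopt_le`, `sum_integral_weight_adopt_le`). A maximum principle on the finite set
of configurations then bounds the probability of never reaching consensus on `b` by the current `W`
(`one_sub_successProb_le_weight`).

Initially `W = 1`, so this bound is applied at time `t = 1 / lam`. An individual that ticks exactly
once by then, explores `b` at that tick and is rewarded, prefers `b` at time `t` whatever the others
do. These events depend on disjoint parts of the randomness and each has probability `a = μ * p b /
(K * e)`. Optional stopping gives failure probability at most `(1 - a * (1 - r)) ^ N ≤ exp (-a * N *
(1 - r))` (`one_sub_successProb_none_le`), and the elementary inequality `exp_neg_mul_le` turns this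
into the two-term bound.

The Markov property comes from the sample space: after the first tick of the group, memorylessness
of the exponential law makes the residual sample a fresh one (`lintegral_firstTick_residual`). The
dynamics are therefore rewritten as a recursion on the residual sample (`evolve`, `evolveUntil`). -/

noncomputable section

namespace SocialBandit

open scoped ENNReal

variable {K N : ℕ}

/-! ### Effect of a single tick. -/

/-- The marks of a tick: everything but the time gap. -/
abbrev Marks (K N : ℕ) : Type := Bool × Fin K × Fin N × (Fin K → Bool)

/-- The law of the marks of a tick. -/
def markLaw (K N : ℕ) (μ : I) (p : Fin K → I) : Measure (Marks K N) :=
  (bernoulliMeasure true false μ).prod <|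
    (uniformOn (Set.univ : Set (Fin K))).prod <|
      (uniformOn (Set.univ : Set (Fin N))).prod <|
        Measure.pi fun k => bernoulliMeasure true false (p k)

lemma tickLaw_eq_prod (lam : ℝ) (μ : I) (p : Fin K → I) :
    tickLaw K N lam μ p = (expMeasure lam).prod (markLaw K N μ p) := rfl

/-- The memories after a tick of individual `n` with marks `w`. -/
def adopt (m : Fin N → Memory K) (n : Fin N) (w : Marks K N) : Fin N → Memory K :=
  refine m n (0, w)

/-- The arm chosen at a tick of individual `n` with marks `w`. -/
def pick (m : Fin N → Memory K) (n : Fin N) (w : Marks K N) : Option (Fin K) :=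
  choose m n (0, w)

lemma adopt_of_ne (m : Fin N → Memory K) {n n' : Fin N} (w : Marks K N) (h : n' ≠ n) :
    adopt m n w n' = m n' := by
  unfold adopt refine
  cases choose m n (0, w) with
  | none => rfl
  | some k =>
    dsimp only
    split_ifs
    · simp [h]
    · rfl

lemma tickTime_zero (ω : Sample K N) (n : Fin N) : tickTime ω n 0 = gap (ω (n, 0)) := by
  simp [tickTime]

/-- The marks make an individual without preference explore arm `b` and adopt it. -/
def Discovers (b : Fin K) (w : Marks K N) : Prop :=
  w.1 = true ∧ w.2.1 = b ∧ w.2.2.2 b = true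

lemma adopt_of_discovers {b : Fin K} {w : Marks K N} (h : Discovers b w) {m : Fin N → Memory K}
    {n : Fin N} (hn : m n = none) : adopt m n w n = some b := by
  obtain ⟨h1, h2, h3⟩ := h
  simp [adopt, refine, choose, hn, explore, uniformArm, reward, h1, h2, h3]

/-- Consensus on arm `b` is preserved. -/
lemma adopt_const (b : Fin K) (n : Fin N) (w : Marks K N) :
    adopt (fun _ => some b) n w = fun _ => some b := by
  simp only [adopt, refine, choose]
  split_ifs
  · exact Function.update_eq_self n _
  · rfl

/-! ### Pathwise dynamics, restarted after each tick of the group. -/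

/-- The index, in the original sample, of the tick `i` counted after the first tick of `n`. -/
def skip (n : Fin N) (i : Fin N × ℕ) : Fin N × ℕ := if i.1 = n then (i.1, i.2 + 1) else i

/-- Let the waiting clocks other than that of `n` run for a time `t`. -/
def age (n : Fin N) (t : ℝ) (ω : Sample K N) : Sample K N :=
  fun i => if i.1 ≠ n ∧ i.2 = 0 then (gap (ω i) - t, (ω i).2) else ω i

section Dynamics

variable [NeZero N]

/-- The individual whose clock ticks first. -/
def firstTicker (ω : Sample K N) : Fin N := nextTicker ω fun _ => 0

/-- The data of the first tick of the group. -/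
def firstTick (ω : Sample K N) : TickData K N := ω (firstTicker ω, 0)

/-- The sample seen by an observer started right after the first tick of the group. -/
def residual (ω : Sample K N) : Sample K N :=
  age (firstTicker ω) (gap (firstTick ω)) fun i => ω (skip (firstTicker ω) i)

/-- The memories after `l` ticks of the group, started from the memories `m`. -/
def evolve : (Fin N → Memory K) → Sample K N → ℕ → (Fin N → Memory K)
  | m, _, 0 => m
  | m, ω, l + 1 => evolve (adopt m (firstTicker ω) (firstTick ω).2) (residual ω) l

/-- The memories after those of the first `l` ticks of the group that occur up to time `T`,
started from the memories `m`. -/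
def evolveUntil : (Fin N → Memory K) → Sample K N → ℝ → ℕ → (Fin N → Memory K)
  | m, _, _, 0 => m
  | m, ω, T, l + 1 =>
    if gap (firstTick ω) ≤ T then
      evolveUntil (adopt m (firstTicker ω) (firstTick ω).2) (residual ω)
        (T - gap (firstTick ω)) l
    else m

lemma nextTicker_spec (ω : Sample K N) (c : Fin N → ℕ) (n : Fin N) :
    tickTime ω (nextTicker ω c) (c (nextTicker ω c)) ≤ tickTime ω n (c n) := by
  have h := Finset.min'_mem (Finset.univ.filter fun n => ∀ n', tickTime ω n (c n) ≤
    tickTime ω n' (c n')) (by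
      obtain ⟨n, -, hn⟩ := Finset.exists_min_image Finset.univ (fun n => tickTime ω n (c n))
        ⟨0, Finset.mem_univ _⟩
      exact ⟨n, by simpa using hn⟩)
  exact (Finset.mem_filter.1 h).2 n

/-- The least index wins a tie, so smaller indices must be strictly later and larger ones only
weakly. In this form, being next is a condition on each other clock separately. -/
lemma nextTicker_eq_iff (ω : Sample K N) (c : Fin N → ℕ) (n : Fin N) :
    nextTicker ω c = n ↔ ∀ n', n' ≠ n → if n' < n then tickTime ω n (c n) < tickTime ω n' (c n')
      else tickTime ω n (c n) ≤ tickTime ω n' (c n') := by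
  have hle : ∀ n', (∀ k, tickTime ω n' (c n') ≤ tickTime ω k (c k)) → nextTicker ω c ≤ n' :=
    fun n' h => Finset.min'_le _ _ (by simpa using h)
  constructor
  · rintro rfl n' -
    split_ifs with h
    · by_contra! hc
      exact absurd (hle n' fun k => hc.trans (nextTicker_spec ω c k)) (not_le.2 h)
    · exact nextTicker_spec ω c n'
  · intro h
    have hmin : ∀ k, tickTime ω n (c n) ≤ tickTime ω k (c k) := by
      intro k
      by_cases hk : k = n
      · rw [hk]
      · have := h k hk
        split_ifs at this
        · exact this.le
        · exact this
    by_contra hne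
    have h1 := h _ hne
    rw [if_pos (lt_of_le_of_ne (hle n hmin) hne)] at h1
    exact absurd (nextTicker_spec ω c n) (not_le.2 h1)

lemma nextTicker_congr {ω ω' : Sample K N} {c c' : Fin N → ℕ} {s : ℝ}
    (h : ∀ n, tickTime ω' n (c' n) = tickTime ω n (c n) - s) :
    nextTicker ω' c' = nextTicker ω c := by
  rw [nextTicker_eq_iff]
  intro n' hn'
  have := (nextTicker_eq_iff ω c _).1 rfl n' hn'
  simpa [h] using this

lemma firstTicker_eq_iff (ω : Sample K N) (n : Fin N) :
    firstTicker ω = n ↔ ∀ n', n' ≠ n → if n' < n then gap (ω (n, 0)) < gap (ω (n', 0))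
      else gap (ω (n, 0)) ≤ gap (ω (n', 0)) := by
  simpa [tickTime_zero, firstTicker] using nextTicker_eq_iff ω (fun _ => 0) n

lemma gap_firstTick_le (ω : Sample K N) (n : Fin N) : gap (firstTick ω) ≤ tickTime ω n 0 := by
  simpa [tickTime_zero, firstTick, firstTicker] using nextTicker_spec ω (fun _ => 0) n

lemma tickTime_residual (ω : Sample K N) (n : Fin N) (j : ℕ) :
    tickTime (residual ω) n j =
      tickTime ω n (if n = firstTicker ω then j + 1 else j) - gap (firstTick ω) := by
  unfold tickTime
  split_ifs with h
  · rw [Finset.sum_range_succ' _ (j + 1), firstTick, ← h, add_sub_cancel_right]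
    refine Finset.sum_congr rfl fun i _ => ?_
    simp [residual, age, skip, ← h]
  · rw [Finset.sum_range_succ', Finset.sum_range_succ' _ j]
    have h0 : gap (residual ω (n, 0)) = gap (ω (n, 0)) - gap (firstTick ω) := by
      simp [residual, age, skip, h, gap]
    have h1 : ∀ i, gap (residual ω (n, i + 1)) = gap (ω (n, i + 1)) := by
      intro i; simp [residual, age, skip, h, gap]
    rw [h0, Finset.sum_congr rfl fun i _ => h1 i]
    ring

lemma marks_residual (ω : Sample K N) (n : Fin N) (j : ℕ) :
    (residual ω (n, j)).2 = (ω (n, if n = firstTicker ω then j + 1 else j)).2 := by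
  by_cases h : n = firstTicker ω
  · simp [residual, age, skip, ← h]
  · simp only [residual, age, skip, h, if_false]
    split_ifs <;> rfl

/-- The induction has to allow an observer who starts after `l` ticks with a time origin moved to
`s`. A common shift of all tick times does not change their order, so both descriptions select the
same tickers. -/
lemma evolve_run (ω : Sample K N) (k : ℕ) : ∀ (l : ℕ) (ω' : Sample K N) (s : ℝ),
    (∀ n j, tickTime ω' n j = tickTime ω n ((run ω l).2 n + j) - s) →
    (∀ n j, (ω' (n, j)).2 = (ω (n, (run ω l).2 n + j)).2) →
    evolve (run ω l).1 ω' k = (run ω (l + k)).1 := by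
  induction k with
  | zero => intros; rfl
  | succ k ih =>
    intro l ω' s ht hm
    have hf : firstTicker ω' = nextTicker ω (run ω l).2 :=
      nextTicker_congr (s := s) fun n => by simpa using ht n 0
    have hrun : (run ω (l + 1)).2 = Function.update (run ω l).2 (firstTicker ω')
        ((run ω l).2 (firstTicker ω') + 1) := by rw [hf]; rfl
    have hcount : ∀ n j, (run ω (l + 1)).2 n + j =
        (run ω l).2 n + if n = firstTicker ω' then j + 1 else j := by
      intro n j
      rw [hrun]
      by_cases h : n = firstTicker ω'
      · subst h; simp; ring
      · simp [h]
    have hmem : adopt (run ω l).1 (firstTicker ω') (firstTick ω').2 = (run ω (l + 1)).1 := by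
      have := hm (firstTicker ω') 0
      rw [firstTick, this, hf]
      rfl
    rw [evolve, hmem, ih (l + 1) (residual ω') (s + gap (firstTick ω'))]
    · congr 2; ring
    · intro n j
      rw [tickTime_residual, ht, hcount]; ring
    · intro n j
      rw [marks_residual, hm, hcount]

lemma run_eq_evolve (ω : Sample K N) (l : ℕ) : (run ω l).1 = evolve (fun _ => none) ω l := by
  have := evolve_run ω l 0 ω 0 (by intro n j; simp [run]) (by intro n j; simp [run])
  rw [zero_add] at this
  exact this.symm

/-- A memory changes only at a tick of its owner. -/
lemma evolveUntil_of_lt (l : ℕ) : ∀ (m : Fin N → Memory K) (ω : Sample K N) (T : ℝ) (n : Fin N),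
    T < tickTime ω n 0 → evolveUntil m ω T l n = m n := by
  induction l with
  | zero => intros; rfl
  | succ l ih =>
    intro m ω T n h
    rw [evolveUntil]
    split_ifs with hT
    · have hne : n ≠ firstTicker ω := by
        rintro rfl
        rw [tickTime_zero] at h
        exact absurd hT (not_le.2 h)
      rw [ih, adopt_of_ne _ _ hne]
      rw [tickTime_residual, if_neg hne]
      linarith
    · rfl

/-- The function `k` bounds the number of ticks of each clock up to `T`, so `l` steps exhaust them
all. Until its tick `n` has no preference and thus explores; having no second tick by `T`, it cannot
lose `b` again. -/
lemma evolveUntil_of_discovers {b : Fin K} {n : Fin N} (l : ℕ) :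
    ∀ (m : Fin N → Memory K) (ω : Sample K N) (T : ℝ) (k : Fin N → ℕ),
    (∀ n', T < tickTime ω n' (k n')) → ∑ n', k n' ≤ l → m n = none →
    tickTime ω n 0 ≤ T → T < tickTime ω n 1 → Discovers b (ω (n, 0)).2 →
    evolveUntil m ω T l n = some b := by
  induction l with
  | zero =>
    intro m ω T k hk hs _ h0 _ _
    have : k n = 0 := by
      have := Finset.single_le_sum (fun _ _ => Nat.zero_le _) (Finset.mem_univ n) (f := k)
      omega
    have := hk n
    rw [‹k n = 0›] at this
    exact absurd h0 (not_le.2 this)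
  | succ l ih =>
    intro m ω T k hk hs hm h0 h1 hd
    have hT : gap (firstTick ω) ≤ T := (gap_firstTick_le ω n).trans h0
    rw [evolveUntil, if_pos hT]
    by_cases hn : n = firstTicker ω
    · rw [evolveUntil_of_lt]
      · rw [firstTick, ← hn]
        exact adopt_of_discovers hd hm
      · rw [tickTime_residual, if_pos hn]
        simpa using h1
    · have hk0 : k (firstTicker ω) ≠ 0 := by
        intro h
        have := hk (firstTicker ω)
        rw [h, tickTime_zero] at this
        exact absurd hT (not_le.2 this)
      -- Another clock ticked: one unit of its budget is spent, and `n` is untouched.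
      refine ih _ _ _ (Function.update k (firstTicker ω) (k (firstTicker ω) - 1)) ?_ ?_ ?_ ?_ ?_ ?_
      · intro n'
        rw [tickTime_residual]
        by_cases hn' : n' = firstTicker ω
        · subst hn'
          simp only [if_true, Function.update_self]
          rw [Nat.sub_add_cancel (Nat.one_le_iff_ne_zero.2 hk0)]
          linarith [hk (firstTicker ω)]
        · simp only [hn', if_false, ne_eq, not_false_iff, Function.update_of_ne]
          linarith [hk n']
      · rw [Finset.sum_update_of_mem (Finset.mem_univ _)]
        rw [← Finset.add_sum_erase _ _ (Finset.mem_univ (firstTicker ω))] at hs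
        rw [Finset.sdiff_singleton_eq_erase]
        omega
      · rw [adopt_of_ne _ _ hn, hm]
      · rw [tickTime_residual, if_neg hn]; linarith
      · rw [tickTime_residual, if_neg hn]; linarith
      · rw [marks_residual, if_neg hn]; exact hd

/-! ### Consensus is absorbing; its link with convergence and learning. -/

lemma evolve_const (b : Fin K) (l : ℕ) : ∀ ω : Sample K N,
    evolve (fun _ => some b) ω l = fun _ => some b := by
  induction l with
  | zero => intro; rfl
  | succ l ih => intro ω; rw [evolve, adopt_const, ih]

lemma run_const_of_le {b : Fin K} {ω : Sample K N} {l l' : ℕ} (h : l ≤ l')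
    (hl : (run ω l).1 = fun _ => some b) : (run ω l').1 = fun _ => some b := by
  induction l', h using Nat.le_induction with
  | base => exact hl
  | succ l' _ ih =>
    change adopt (run ω l').1 _ _ = _
    rw [ih, adopt_const]

/-- Reaching consensus is invariant under restarting after one tick, which is what makes its
probability harmonic. A consensus already present in `m` survives that tick. -/
lemma exists_evolve_const_iff (b : Fin K) (m : Fin N → Memory K) (ω : Sample K N) :
    (∃ l, evolve m ω l = fun _ => some b) ↔
      ∃ l, evolve (adopt m (firstTicker ω) (firstTick ω).2) (residual ω) l = fun _ => some b := by
  constructor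
  · rintro ⟨l, hl⟩
    cases l with
    | zero =>
      refine ⟨0, ?_⟩
      change m = _ at hl
      rw [hl]
      exact adopt_const _ _ _
    | succ l => exact ⟨l, hl⟩
  · rintro ⟨l, hl⟩
    exact ⟨l + 1, hl⟩

theorem absorbedAt_subset_everyoneLearns (b : Fin K) :
    (absorbedAt N b : Set (Sample K N)) ⊆ everyoneLearns N b := by
  intro ω hω n
  -- Finitely many integer counts converge only by being eventually constant.
  have hev : ∀ᶠ t in atTop, state ω t = Pi.single (some b) N := by
    have : ∀ a, ∀ᶠ t in atTop, state ω t a = (Pi.single (some b) N : Memory K → ℕ) a := fun a =>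
      
      (tendsto_pi_nhds.1 hω a).eventually ((isOpen_discrete {_}).mem_nhds rfl)
    filter_upwards [eventually_all.2 this] with t ht
    exact funext ht
  obtain ⟨t, ht⟩ := hev.exists
  have hall : (run ω (tickCount ω t)).1 = fun _ => some b := by
    have h := congrFun ht (some b)
    simp only [state, Pi.single_eq_same] at h
    have h2 : (Finset.univ.filter fun n => memoryAt ω t n = some b) = Finset.univ :=
      Finset.eq_univ_of_card _ (by simpa using h)
    funext n
    have := Finset.mem_univ n
    rw [← h2] at this
    exact (Finset.mem_filter.1 this).2
  -- Only finitely many group ticks precede the consensus, so their times are bounded; this works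
  -- for every sample point, without an almost sure restriction.
  obtain ⟨t₀, ht₀⟩ := ((Set.finite_lt_nat (tickCount ω t)).image (groupTickTime ω)).bddAbove
  refine ⟨t₀, fun l hl _ => ?_⟩
  have hle : tickCount ω t ≤ l := by
    by_contra! h
    exact absurd (ht₀ ⟨l, h, rfl⟩) (not_le.2 hl)
  simp only [pulled, run_const_of_le hle hall, choose]

theorem mem_absorbedAt {b : Fin K} {ω : Sample K N} (hpos : ∀ i, 0 ≤ gap (ω i))
    (hlong : ∀ n (T : ℝ), ∃ j, T < gap (ω (n, j)))
    (h : ∃ l, evolve (fun _ => none) ω l = fun _ => some b) : ω ∈ absorbedAt N b := by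
  obtain ⟨l, hl⟩ := h
  rw [← run_eq_evolve] at hl
  have hmono : ∀ n, Monotone (tickTime ω n) := fun n => monotone_nat_of_le_succ fun j => by
    rw [tickTime, tickTime, Finset.sum_range_succ _ (j + 1)]
    linarith [hpos (n, j + 1)]
  -- Finiteness matters because `Set.ncard` is `0` on infinite sets: if a clock exploded,
  -- `tickCount` would lose its ticks. One gap longer than `t` excludes this.
  have hfin : ∀ n (t : ℝ), {j : ℕ | tickTime ω n j ≤ t}.Finite := by
    intro n t
    obtain ⟨j, hj⟩ := hlong n t
    refine (Set.finite_lt_nat j).subset fun i hi => ?_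
    by_contra! hc
    have h1 : gap (ω (n, j)) ≤ tickTime ω n j :=
      Finset.single_le_sum (f := fun i => gap (ω (n, i))) (fun i _ => hpos _)
        (Finset.mem_range.2 j.lt_succ_self)
    have h2 := hmono n (show j ≤ i by simpa using hc)
    have h3 : tickTime ω n i ≤ t := hi
    linarith
  refine tendsto_const_nhds.congr' ?_
  filter_upwards [eventually_ge_atTop (tickTime ω 0 l)] with t ht
  have hcount : l ≤ tickCount ω t := by
    have h1 : l ≤ {j : ℕ | tickTime ω 0 j ≤ t}.ncard := by
      have := Set.ncard_le_ncard (s := Set.Iio l) (t := {j : ℕ | tickTime ω 0 j ≤ t})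
        (fun j hj => (hmono 0 (le_of_lt hj)).trans ht) (hfin 0 t)
      simpa [Set.ncard_eq_toFinset_card'] using this
    exact h1.trans (Finset.single_le_sum (f := fun n => {j : ℕ | tickTime ω n j ≤ t}.ncard)
      (fun _ _ => Nat.zero_le _) (Finset.mem_univ _))
  funext a
  simp only [state, memoryAt, run_const_of_le hcount hl]
  by_cases ha : a = some b
  · subst ha; simp
  · simp [ha, Ne.symm ha]

end Dynamics

instance : MeasurableSpace (Memory K) := ⊤

instance : DiscreteMeasurableSpace (Memory K) := ⟨fun _ => trivial⟩

/-! ### Memorylessness of the exponential law. -/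

section Exponential

variable {lam : ℝ}

lemma expMeasure_eq_withDensity (lam : ℝ) :
    expMeasure lam = volume.withDensity (exponentialPDF lam) := rfl

lemma measurable_exponentialPDF (lam : ℝ) : Measurable (exponentialPDF lam) :=
  (measurable_exponentialPDFReal lam).ennreal_ofReal

instance : NullSingletonClass (expMeasure lam) := by
  rw [expMeasure_eq_withDensity]; infer_instance

instance : SFinite (expMeasure lam) := by
  rw [expMeasure_eq_withDensity]; infer_instance

lemma ae_nonneg_expMeasure (lam : ℝ) : ∀ᵐ x ∂expMeasure lam, 0 ≤ x := by
  rw [expMeasure_eq_withDensity, ae_withDensity_iff (measurable_exponentialPDF lam)]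
  refine ae_of_all _ fun x hx => ?_
  by_contra! h
  exact hx (exponentialPDF_of_neg h)

/-- The exponential law is memoryless. -/
lemma map_sub_restrict_Ici_expMeasure {t : ℝ} (ht : 0 ≤ t) :
    ((expMeasure lam).restrict (Set.Ici t)).map (fun x => x - t) =
      ENNReal.ofReal (Real.exp (-(lam * t))) • expMeasure lam := by
  ext A hA
  have hm : Measurable fun x : ℝ => x - t := by fun_prop
  rw [Measure.map_apply hm hA, Measure.restrict_apply (hm hA), Measure.smul_apply,
    expMeasure_eq_withDensity, withDensity_apply _ ((hm hA).inter measurableSet_Ici),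
    withDensity_apply _ hA, ← lintegral_indicator ((hm hA).inter measurableSet_Ici),
    ← lintegral_indicator hA, smul_eq_mul,
    ← lintegral_const_mul _ ((measurable_exponentialPDF lam).indicator hA),
    ← lintegral_add_right_eq_self _ t]
  refine lintegral_congr fun x => ?_
  by_cases hx : x ∈ A
  · by_cases h0 : 0 ≤ x
    · have h1 : x + t ∈ (fun x => x - t) ⁻¹' A ∩ Set.Ici t := by simpa [hx] using h0
      rw [Set.indicator_of_mem h1, Set.indicator_of_mem hx, exponentialPDF_of_nonneg h0,
        exponentialPDF_of_nonneg (add_nonneg h0 ht), ← ENNReal.ofReal_mul (Real.exp_pos _).le]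
      congr 1
      rw [mul_left_comm, ← Real.exp_add]
      ring_nf
    · have h1 : x + t ∉ (fun x => x - t) ⁻¹' A ∩ Set.Ici t := by simp [h0]
      rw [Set.indicator_of_notMem h1, Set.indicator_of_mem hx,
        exponentialPDF_of_neg (not_le.1 h0), mul_zero]
  · have h1 : x + t ∉ (fun x => x - t) ⁻¹' A ∩ Set.Ici t := by simp [hx]
    rw [Set.indicator_of_notMem h1, Set.indicator_of_notMem hx, mul_zero]

/-- The endpoint is null, so the tie-breaking rule has no influence on the law. -/
lemma map_sub_restrict_expMeasure {t : ℝ} (ht : 0 ≤ t) (q : Prop) [Decidable q] :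
    ((expMeasure lam).restrict (if q then Set.Ioi t else Set.Ici t)).map (fun x => x - t) =
      ENNReal.ofReal (Real.exp (-(lam * t))) • expMeasure lam := by
  split_ifs
  · rw [Measure.restrict_congr_set Ioi_ae_eq_Ici, map_sub_restrict_Ici_expMeasure ht]
  · exact map_sub_restrict_Ici_expMeasure ht

end Exponential

/-! ### Renewal of the whole sample at the first tick of the group. -/

lemma measurable_gap : Measurable (gap : TickData K N → ℝ) := measurable_fst

lemma ae_gap_nonneg (lam : ℝ) (μ : I) (p : Fin K → I) : ∀ᵐ z ∂tickLaw K N lam μ p, 0 ≤ gap z :=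
  Measure.quasiMeasurePreserving_fst.ae (ae_nonneg_expMeasure lam)

lemma measurable_age (n : Fin N) :
    Measurable fun q : ℝ × Sample K N => age n q.1 q.2 := by
  refine measurable_pi_lambda _ fun i => ?_
  by_cases h : i.1 ≠ n ∧ i.2 = 0
  · simp only [age, if_pos h, gap]
    fun_prop
  · simp only [age, h, if_false]
    fun_prop

/-- The clocks other than that of `n` do not tick before time `t`; ties are broken as in
`nextTicker`. -/
def waiting (n : Fin N) (t : ℝ) : Set (Sample K N) :=
  {ω | ∀ n', n' ≠ n → gap (ω (n', 0)) ∈ if n' < n then Set.Ioi t else Set.Ici t}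

lemma measurableSet_waiting_prod (n : Fin N) :
    MeasurableSet {q : ℝ × Sample K N | q.2 ∈ waiting n q.1} := by
  have : {q : ℝ × Sample K N | q.2 ∈ waiting n q.1} = ⋂ n', ⋂ (_ : n' ≠ n),
      {q | gap (q.2 (n', 0)) ∈ if n' < n then Set.Ioi q.1 else Set.Ici q.1} := by
    ext q
    simp [waiting]
  rw [this]
  refine MeasurableSet.iInter fun (n' : Fin N) => MeasurableSet.iInter fun (_ : n' ≠ n) => ?_
  have hg : Measurable fun q : ℝ × Sample K N => gap (q.2 (n', 0)) :=
    measurable_gap.comp ((measurable_pi_apply _).comp measurable_snd)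
  split_ifs
  · exact measurableSet_lt measurable_fst hg
  · exact measurableSet_le measurable_fst hg

lemma measurableSet_waiting (n : Fin N) (t : ℝ) :
    MeasurableSet (waiting n t : Set (Sample K N)) :=
  measurable_prodMk_left (measurableSet_waiting_prod n)

/-- Separates the first tick of `n` from the rest of the sample, which is independent of it. -/
lemma firstTicker_eq_iff_waiting [NeZero N] (ω : Sample K N) (n : Fin N) :
    firstTicker ω = n ↔ (fun i => ω (skip n i)) ∈ waiting n (gap (ω (n, 0))) := by
  rw [firstTicker_eq_iff]
  refine forall₂_congr fun n' hn' => ?_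
  simp only [skip, hn', if_false]
  split_ifs <;> rfl

/-- Insert a new first tick of `n` into a sample. -/
def insertTick (n : Fin N) (q : TickData K N × Sample K N) : Sample K N :=
  fun i => if i = (n, 0) then q.1 else q.2 (if i.1 = n then (i.1, i.2 - 1) else i)

lemma measurable_insertTick (n : Fin N) :
    Measurable (insertTick n : TickData K N × Sample K N → Sample K N) := by
  refine measurable_pi_lambda _ fun i => ?_
  by_cases h : i = (n, 0)
  · simp only [insertTick, h, if_true]; fun_prop
  · simp only [insertTick, h, if_false]; fun_prop

lemma isProbabilityMeasure_uniformOn_univ_fin (n : ℕ) [NeZero n] :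
    IsProbabilityMeasure (uniformOn (Set.univ : Set (Fin n))) :=
  isProbabilityMeasure_uniformOn Set.finite_univ Set.univ_nonempty

/-- A waiting clock that has not ticked at time `t` starts anew. -/
lemma tickLaw_age {lam : ℝ} {μ : I} {p : Fin K → I} {t : ℝ} (ht : 0 ≤ t) (q : Prop) [Decidable q] {A : Set (TickData K N)}
    (hA : MeasurableSet A) :
    tickLaw K N lam μ p {z | gap z ∈ (if q then Set.Ioi t else Set.Ici t) ∧
      ((gap z - t, z.2) : TickData K N) ∈ A} =
      ENNReal.ofReal (Real.exp (-(lam * t))) * tickLaw K N lam μ p A := by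
  have hD : MeasurableSet (if q then Set.Ioi t else Set.Ici t) := by
    split_ifs <;> measurability
  have hm : Measurable (Prod.map (fun x : ℝ => x - t) (id : Marks K N → Marks K N)) := by fun_prop
  have key : ((tickLaw K N lam μ p).restrict
      ((if q then Set.Ioi t else Set.Ici t) ×ˢ Set.univ)).map (Prod.map (fun x => x - t) id) =
      ENNReal.ofReal (Real.exp (-(lam * t))) • tickLaw K N lam μ p := by
    rw [tickLaw_eq_prod, ← Measure.prod_restrict, Measure.restrict_univ,
      ← Measure.map_prod_map _ _ (by fun_prop) measurable_id, map_sub_restrict_expMeasure ht,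
      Measure.map_id, Measure.prod_smul_left]
  have := congrArg (fun ν => ν A) key
  simp only [Measure.smul_apply, smul_eq_mul] at this
  rw [← this, Measure.map_apply hm hA, Measure.restrict_apply (hm hA)]
  congr 1
  ext z
  change (_ ∧ _) ↔ (_ ∧ (_ ∧ True))
  rw [and_true, and_comm]
  rfl

section Law

variable [NeZero K] [NeZero N] {lam : ℝ} [hlam : Fact (0 < lam)] {μ : I} {p : Fin K → I}

instance : IsProbabilityMeasure (expMeasure lam) := isProbabilityMeasure_expMeasure hlam.out

instance : IsProbabilityMeasure (markLaw K N μ p) := by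
  have := isProbabilityMeasure_uniformOn_univ_fin K
  have := isProbabilityMeasure_uniformOn_univ_fin N
  unfold markLaw
  infer_instance

instance : IsProbabilityMeasure (tickLaw K N lam μ p) := by
  rw [tickLaw_eq_prod]
  infer_instance

instance : IsProbabilityMeasure (law K N lam μ p) := by
  unfold law
  infer_instance

/-- Each of the `N - 1` other clocks survives to time `t` with probability `exp (-(lam * t))`,
independently, and then starts anew. After division by the total mass the claim is an identity of
product measures, to be tested on boxes. -/
lemma map_age_restrict_law (n : Fin N) {t : ℝ} (ht : 0 ≤ t) :
    ((law K N lam μ p).restrict (waiting n t)).map (age n t) =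
      ENNReal.ofReal (Real.exp (-(lam * t))) ^ (N - 1) • law K N lam μ p := by
  set e := ENNReal.ofReal (Real.exp (-(lam * t))) with he
  have he0 : e ^ (N - 1) ≠ 0 := pow_ne_zero _ (by simp [he, Real.exp_pos])
  have het : e ^ (N - 1) ≠ ∞ := ENNReal.pow_ne_top ENNReal.ofReal_ne_top
  have hage : Measurable (age n t : Sample K N → Sample K N) :=
    (measurable_age n).comp measurable_prodMk_left
  suffices (e ^ (N - 1))⁻¹ • ((law K N lam μ p).restrict (waiting n t)).map (age n t) =
      law K N lam μ p by
    rw [← this, smul_smul, ENNReal.mul_inv_cancel he0 het, one_smul, this]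
  refine Measure.eq_infinitePi _ fun s A hA => ?_
  set s₀ : Finset (Fin N × ℕ) := (Finset.univ.erase n).image fun n' => (n', 0) with hs₀
  have hmem : ∀ i : Fin N × ℕ, i ∈ s₀ ↔ i.1 ≠ n ∧ i.2 = 0 := by
    rintro ⟨a, j⟩
    simp [hs₀, eq_comm]
  have hcard : s₀.card = N - 1 := by
    rw [hs₀, Finset.card_image_of_injective _ (fun a b h => by simpa using h)]
    simp
  set A' : Fin N × ℕ → Set (TickData K N) := fun i => if i ∈ s then A i else Set.univ with hA'
  have hA'm : ∀ i, MeasurableSet (A' i) := by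
    intro i; simp only [hA']; split_ifs
    · exact hA i
    · exact .univ
  set B : Fin N × ℕ → Set (TickData K N) := fun i =>
    if i ∈ s₀ then {z | gap z ∈ (if i.1 < n then Set.Ioi t else Set.Ici t) ∧
      ((gap z - t, z.2) : TickData K N) ∈ A' i} else A' i with hB
  have hBm : ∀ i, MeasurableSet (B i) := by
    intro i; simp only [hB]; split_ifs
    · refine MeasurableSet.inter (measurable_gap measurableSet_Ioi) ?_
      exact (show Measurable fun z : TickData K N => ((gap z - t, z.2) : TickData K N) by
        unfold gap; fun_prop) (hA'm i)
    · refine MeasurableSet.inter (measurable_gap measurableSet_Ici) ?_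
      exact (show Measurable fun z : TickData K N => ((gap z - t, z.2) : TickData K N) by
        unfold gap; fun_prop) (hA'm i)
    · exact hA'm i
  -- Aging and waiting act coordinatewise, so the preimage of a box is a box; only the first ticks
  -- of the other clocks, indexed by `s₀`, contribute a survival factor.
  have hbox : age n t ⁻¹' (Set.pi s A) ∩ waiting n t =
      Set.pi (↑(s ∪ s₀) : Set (Fin N × ℕ)) B := by
    ext ω
    simp only [Set.mem_inter_iff, Set.mem_preimage, Set.mem_pi, Finset.mem_coe, waiting,
      Set.mem_ofPred_eq, Finset.mem_union]
    constructor
    · rintro ⟨h1, h2⟩ i hi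
      by_cases h0 : i ∈ s₀
      · simp only [hB, h0, if_true, Set.mem_ofPred_eq]
        obtain ⟨ha, hb⟩ := (hmem i).1 h0
        have hi' : i = (i.1, 0) := by rw [← hb]
        refine ⟨by rw [hi']; exact h2 i.1 ha, ?_⟩
        simp only [hA']
        split_ifs with hs
        · have := h1 i hs
          rwa [age, if_pos ⟨ha, hb⟩] at this
        · trivial
      · have hs : i ∈ s := by tauto
        have := h1 i hs
        rw [age, if_neg (fun h => h0 ((hmem i).2 h))] at this
        simpa only [hB, h0, if_false, hA', hs, if_true] using this
    · intro h
      refine ⟨fun i hi => ?_, fun n' hn' => ?_⟩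
      · have := h i (Or.inl hi)
        by_cases h0 : i ∈ s₀
        · simp only [hB, h0, if_true, Set.mem_ofPred_eq, hA', hi] at this
          rw [age, if_pos ((hmem i).1 h0)]
          exact this.2
        · simp only [hB, h0, if_false, hA', hi, if_true] at this
          rwa [age, if_neg (fun h => h0 ((hmem i).2 h))]
      · have h0 : ((n', 0) : Fin N × ℕ) ∈ s₀ := (hmem _).2 ⟨hn', rfl⟩
        have := h (n', 0) (Or.inr h0)
        simp only [hB, h0, if_true, Set.mem_ofPred_eq] at this
        exact this.1
  have hBt : ∀ i, tickLaw K N lam μ p (B i) =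
      (if i ∈ s₀ then e else 1) * tickLaw K N lam μ p (A' i) := by
    intro i
    by_cases h0 : i ∈ s₀
    · simp only [hB, h0, if_true]
      exact tickLaw_age ht _ (hA'm i)
    · simp only [hB, h0, if_false, one_mul]
  have hboxm : MeasurableSet (Set.pi (s : Set (Fin N × ℕ)) A) :=
    .pi s.countable_toSet fun i _ => hA i
  rw [Measure.smul_apply, Measure.map_apply hage hboxm, Measure.restrict_apply (hage hboxm), hbox,
    law, Measure.infinitePi_pi _ fun i _ => hBm i, Finset.prod_congr rfl fun i _ => hBt i,
    Finset.prod_mul_distrib, Finset.prod_ite_mem, Finset.prod_const,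
    Finset.union_inter_cancel_right, hcard, smul_eq_mul, ← mul_assoc,
    ENNReal.inv_mul_cancel he0 het, one_mul]
  rw [← Finset.prod_subset Finset.subset_union_left]
  · exact Finset.prod_congr rfl fun i hi => by simp only [hA', hi, if_true]
  · intro i _ hi
    simp only [hA', hi, if_false, measure_univ]

/-- All ticks have the same law and are independent, so shifting one clock by a fresh independent
tick preserves the product law. -/
lemma map_insertTick (n : Fin N) :
    ((tickLaw K N lam μ p).prod (law K N lam μ p)).map (insertTick n) = law K N lam μ p := by
  refine Measure.eq_infinitePi _ fun s A hA => ?_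
  set g : Fin N × ℕ → Fin N × ℕ := fun i => if i.1 = n then (i.1, i.2 - 1) else i with hg
  have hsg : ∀ i, i ≠ (n, 0) → skip n (g i) = i := by
    rintro ⟨a, j⟩ hi
    by_cases h : a = n
    · subst h
      have : j ≠ 0 := by simpa using hi
      simp [hg, skip]; omega
    · simp [hg, skip, h]
  have hbox : insertTick n ⁻¹' (Set.pi (s : Set (Fin N × ℕ)) A) =
      (if (n, 0) ∈ s then A (n, 0) else Set.univ) ×ˢ
        Set.pi (↑((s.erase (n, 0)).image g) : Set (Fin N × ℕ)) fun i => A (skip n i) := by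
    ext q
    simp only [Set.mem_preimage, Set.mem_pi, Finset.mem_coe, Set.mem_prod, Finset.mem_image,
      Finset.mem_erase]
    constructor
    · intro h
      refine ⟨?_, ?_⟩
      · split_ifs with h0
        · simpa [insertTick] using h _ h0
        · trivial
      · rintro _ ⟨i, ⟨hi, his⟩, rfl⟩
        rw [hsg i hi]
        simpa only [insertTick, hi, if_false] using h i his
    · rintro ⟨h1, h2⟩ i hi
      by_cases h0 : i = (n, 0)
      · subst h0
        rw [if_pos hi] at h1
        simpa [insertTick] using h1
      · have := h2 (g i) ⟨i, ⟨h0, hi⟩, rfl⟩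
        rw [hsg i h0] at this
        simpa only [insertTick, h0, if_false] using this
  have hinj : Set.InjOn g (↑(s.erase (n, 0)) : Set (Fin N × ℕ)) := by
    intro i hi j hj h
    have hi' := hsg i (Finset.ne_of_mem_erase hi)
    have hj' := hsg j (Finset.ne_of_mem_erase hj)
    rw [← hi', ← hj', h]
  rw [Measure.map_apply (measurable_insertTick n) (.pi s.countable_toSet fun i _ => hA i), hbox,
    Measure.prod_prod]
  conv_lhs => enter [2]; rw [law, Measure.infinitePi_pi _ fun i _ => hA _]
  rw [Finset.prod_image hinj, Finset.prod_congr rfl fun i hi => by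
    rw [hsg i (Finset.ne_of_mem_erase hi)]]
  by_cases h0 : (n, 0) ∈ s
  · rw [if_pos h0, Finset.mul_prod_erase s (fun i => tickLaw K N lam μ p (A i)) h0]
  · rw [if_neg h0, measure_univ, one_mul, Finset.erase_eq_of_notMem h0]

lemma map_splitTick (n : Fin N) :
    (law K N lam μ p).map (fun ω => (ω (n, 0), fun i => ω (skip n i))) =
      (tickLaw K N lam μ p).prod (law K N lam μ p) := by
  have hm : Measurable fun ω : Sample K N => (ω (n, 0), fun i => ω (skip n i)) := by fun_prop
  conv_lhs => rw [← map_insertTick n]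
  rw [Measure.map_map hm (measurable_insertTick n)]
  convert! Measure.map_id
  ext1 q
  refine Prod.ext (by simp [insertTick]) (funext ?_)
  rintro ⟨a, j⟩
  by_cases h : a = n
  · subst h; simp [insertTick, skip]
  · simp [insertTick, skip, h]

/-- The renewal property: the first tick of the group, and the sample seen right after it. -/
theorem lintegral_firstTick_residual (F : Fin N → TickData K N × Sample K N → ℝ≥0∞)
    (hF : ∀ n, Measurable (F n)) :
    ∫⁻ ω, F (firstTicker ω) (firstTick ω, residual ω) ∂law K N lam μ p =
      ∑ n, ∫⁻ z, ENNReal.ofReal (Real.exp (-(lam * gap z))) ^ (N - 1) *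
        ∫⁻ ω, F n (z, ω) ∂law K N lam μ p ∂tickLaw K N lam μ p := by
  set H : Fin N → TickData K N × Sample K N → ℝ≥0∞ := fun n q =>
    (waiting n (gap q.1)).indicator (fun ω => F n (q.1, age n (gap q.1) ω)) q.2 with hH
  have hHm : ∀ n, Measurable (H n) := by
    intro n
    have hq : Measurable fun q : TickData K N × Sample K N => (gap q.1, q.2) :=
      (measurable_gap.comp measurable_fst).prodMk measurable_snd
    exact Measurable.indicator
      (s := {q : TickData K N × Sample K N | q.2 ∈ waiting n (gap q.1)})
      (f := fun q => F n (q.1, age n (gap q.1) q.2))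
      ((hF n).comp (measurable_fst.prodMk ((measurable_age n).comp hq)))
      (hq (measurableSet_waiting_prod n))
  have hsplit : ∀ n, Measurable fun ω : Sample K N => (ω (n, 0), fun i => ω (skip n i)) :=
    fun n => by fun_prop
  have hsum : ∀ ω : Sample K N, F (firstTicker ω) (firstTick ω, residual ω) =
      ∑ n, H n (ω (n, 0), fun i => ω (skip n i)) := by
    intro ω
    -- Exactly one individual ticks first, so a single term of the sum survives.
    rw [Finset.sum_eq_single (firstTicker ω)]
    · rw [hH]
      simp only
      rw [Set.indicator_of_mem ((firstTicker_eq_iff_waiting ω _).1 rfl)]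
      rfl
    · intro n _ hn
      rw [hH]
      simp only
      rw [Set.indicator_of_notMem]
      exact fun h => hn ((firstTicker_eq_iff_waiting ω n).2 h).symm
    · simp
  simp_rw [hsum]
  rw [lintegral_finsetSum (f := fun n (ω : Sample K N) => H n (ω (n, 0), fun i => ω (skip n i)))
    Finset.univ fun n _ => (hHm n).comp (hsplit n)]
  refine Finset.sum_congr rfl fun n _ => ?_
  rw [← lintegral_map (hHm n) (hsplit n), map_splitTick, lintegral_prod _ (hHm n).aemeasurable]
  refine lintegral_congr_ae ?_
  filter_upwards [ae_gap_nonneg lam μ p] with z hz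
  have hage : Measurable (age n (gap z) : Sample K N → Sample K N) :=
    (measurable_age n).comp measurable_prodMk_left
  have hFz : Measurable fun ω => F n (z, ω) := (hF n).comp measurable_prodMk_left
  simp only [hH]
  rw [lintegral_indicator (measurableSet_waiting n _), ← lintegral_map hFz hage,
    map_age_restrict_law n hz, lintegral_smul_measure, smul_eq_mul]

end Law

/-! ### Measurability of the dynamics and of consensus. -/

section Measurability

lemma measurable_marks : Measurable (Prod.snd : TickData K N → Marks K N) := measurable_snd

variable [NeZero N]

lemma measurable_firstTicker : Measurable (firstTicker : Sample K N → Fin N) := by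
  refine measurable_to_countable' fun n => ?_
  have : firstTicker ⁻¹' {n} = (fun ω : Sample K N => (gap (ω (n, 0)), fun i => ω (skip n i))) ⁻¹'
      {q : ℝ × Sample K N | q.2 ∈ waiting n q.1} := by
    ext ω
    exact firstTicker_eq_iff_waiting ω n
  rw [this]
  have h1 : Measurable fun ω : Sample K N => gap (ω (n, 0)) :=
    measurable_gap.comp (measurable_pi_apply _)
  have h2 : Measurable fun (ω : Sample K N) i => ω (skip n i) := by fun_prop
  exact h1.prodMk h2 (measurableSet_waiting_prod n)

lemma measurable_firstTick : Measurable (firstTick : Sample K N → TickData K N) := by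
  have : Measurable fun q : Fin N × Sample K N => q.2 (q.1, 0) :=
    measurable_from_prod_countable_right fun n => by dsimp only; fun_prop
  exact this.comp (measurable_firstTicker.prodMk measurable_id)

lemma measurable_residual : Measurable (residual : Sample K N → Sample K N) := by
  have : Measurable fun q : Fin N × (ℝ × Sample K N) =>
      age q.1 q.2.1 fun i => q.2.2 (skip q.1 i) := by
    refine measurable_from_prod_countable_right fun n => ?_
    have h : Measurable fun q : ℝ × Sample K N => (q.1, fun i => q.2 (skip n i)) := by fun_prop
    exact (measurable_age n).comp h
  exact this.comp (measurable_firstTicker.prodMk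
    ((measurable_gap.comp measurable_firstTick).prodMk measurable_id))

lemma measurable_adopt_firstTick (m : Fin N → Memory K) :
    Measurable fun ω : Sample K N => adopt m (firstTicker ω) (firstTick ω).2 := by
  have : Measurable fun q : Fin N × Marks K N => adopt m q.1 q.2 := Measurable.of_discrete
  exact this.comp (measurable_firstTicker.prodMk (measurable_marks.comp measurable_firstTick))

lemma measurable_evolve (l : ℕ) :
    ∀ m : Fin N → Memory K, Measurable fun ω : Sample K N => evolve m ω l := by
  induction l with
  | zero => exact fun m => measurable_const
  | succ l ih =>
    intro m
    have : Measurable fun q : (Fin N → Memory K) × Sample K N => evolve q.1 q.2 l :=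
      measurable_from_prod_countable_right ih
    exact this.comp ((measurable_adopt_firstTick m).prodMk measurable_residual)

lemma measurable_evolveUntil (l : ℕ) : ∀ m : Fin N → Memory K,
    Measurable fun q : ℝ × Sample K N => evolveUntil m q.2 q.1 l := by
  induction l with
  | zero => exact fun m => measurable_const
  | succ l ih =>
    intro m
    have h : Measurable fun q : (Fin N → Memory K) × (ℝ × Sample K N) =>
        evolveUntil q.1 q.2.2 q.2.1 l := measurable_from_prod_countable_right ih
    have hg : Measurable fun q : ℝ × Sample K N => gap (firstTick q.2) :=
      measurable_gap.comp (measurable_firstTick.comp measurable_snd)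
    refine Measurable.ite (measurableSet_le hg measurable_fst) ?_ measurable_const
    exact h.comp (((measurable_adopt_firstTick m).comp measurable_snd).prodMk
      ((measurable_fst.sub hg).prodMk (measurable_residual.comp measurable_snd)))

/-- The samples for which the group started from `m` reaches consensus on `b`. -/
def consensus (b : Fin K) (m : Fin N → Memory K) : Set (Sample K N) :=
  {ω | ∃ l, evolve m ω l = fun _ => some b}

lemma measurableSet_consensus (b : Fin K) (m : Fin N → Memory K) :
    MeasurableSet (consensus b m) := by
  have : consensus b m = ⋃ l, (fun ω : Sample K N => evolve m ω l) ⁻¹' {fun _ => some b} := by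
    ext ω
    simp [consensus]
  rw [this]
  exact MeasurableSet.iUnion fun l => measurable_evolve l m (measurableSet_singleton _)

end Measurability

lemma measurable_discount (lam : ℝ) (N : ℕ) : Measurable fun t : ℝ =>
    ENNReal.ofReal (Real.exp (-(lam * t))) ^ (N - 1) := by fun_prop

/-! ### The success probability as a harmonic function. -/

section Harmonic

variable [NeZero K] [NeZero N] {lam : ℝ} [hlam : Fact (0 < lam)] {μ : I} {p : Fin K → I}

/-- By symmetry each individual ticks first with probability `1 / N`. The value is read off from the
renewal identity for the constant function `1`, with a single dummy arm. -/
lemma lintegral_discount :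
    (N : ℝ≥0∞) * ∫⁻ t, ENNReal.ofReal (Real.exp (-(lam * t))) ^ (N - 1) ∂expMeasure lam = 1 := by
  have h := lintegral_firstTick_residual (N := N) (K := 1) (lam := lam) (μ := 0) (p := 0)
    (fun _ _ => 1) fun _ => measurable_const
  simp only [lintegral_const, measure_univ, mul_one, Finset.sum_const, Finset.card_univ,
    Fintype.card_fin, nsmul_eq_mul] at h
  rw [h]
  congr 1
  rw [tickLaw_eq_prod, lintegral_prod
    (f := fun z : TickData 1 N => ENNReal.ofReal (Real.exp (-(lam * gap z))) ^ (N - 1))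
    (((measurable_discount lam N).comp measurable_gap).aemeasurable)]
  simp [gap]

/-- The probability that the group started from `m` reaches consensus on `b`. -/
def successProb (lam : ℝ) (μ : I) (p : Fin K → I) (b : Fin K) (m : Fin N → Memory K) : ℝ≥0∞ :=
  law K N lam μ p (consensus b m)

/-- One step of the chain, in which the time of the tick may matter. -/
lemma lintegral_step (F : Fin N → ℝ → Marks K N → ℝ≥0∞)
    (hF : ∀ n, Measurable fun q : ℝ × Marks K N => F n q.1 q.2)
    (G : Fin N → TickData K N × Sample K N → ℝ≥0∞) (hG : ∀ n, Measurable (G n))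
    (hGF : ∀ n z, ∫⁻ ω, G n (z, ω) ∂law K N lam μ p = F n (gap z) z.2) :
    ∫⁻ ω, G (firstTicker ω) (firstTick ω, residual ω) ∂law K N lam μ p =
      ∑ n, ∫⁻ t, ENNReal.ofReal (Real.exp (-(lam * t))) ^ (N - 1) *
        ∫⁻ w, F n t w ∂markLaw K N μ p ∂expMeasure lam := by
  rw [lintegral_firstTick_residual G hG]
  refine Finset.sum_congr rfl fun n _ => ?_
  simp_rw [hGF]
  rw [tickLaw_eq_prod, lintegral_prod]
  · refine lintegral_congr fun t => ?_
    simp only [gap]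
    rw [lintegral_const_mul]
    exact (hF n).comp measurable_prodMk_left
  · exact (((measurable_discount lam N).comp measurable_gap).mul (hF n)).aemeasurable

/-- The success probability is harmonic. -/
lemma successProb_harmonic (b : Fin K) (m : Fin N → Memory K) :
    ∑ n, ∫⁻ w, successProb lam μ p b (adopt m n w) ∂markLaw K N μ p =
      N * successProb lam μ p b m := by
  have h := lintegral_step (K := K) (N := N) (lam := lam) (μ := μ) (p := p)
    (fun n _ w => successProb lam μ p b (adopt m n w))
    (fun n => (Measurable.of_discrete (f := fun w => successProb lam μ p b (adopt m n w))).comp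
      measurable_snd)
    (fun n q => (consensus b (adopt m n q.1.2)).indicator 1 q.2)
    (fun n => by
      have : Measurable fun q : Marks K N × Sample K N =>
          (consensus b (adopt m n q.1)).indicator (1 : Sample K N → ℝ≥0∞) q.2 :=
        measurable_from_prod_countable_right fun w =>
          measurable_one.indicator (measurableSet_consensus b (adopt m n w))
      exact this.comp ((measurable_marks.comp measurable_fst).prodMk measurable_snd))
    (fun n z => by
      exact lintegral_indicator_one (measurableSet_consensus b (adopt m n z.2)))
  have hl : ∫⁻ ω, (consensus b (adopt m (firstTicker ω) (firstTick ω).2)).indicator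
      (1 : Sample K N → ℝ≥0∞) (residual ω) ∂law K N lam μ p = successProb lam μ p b m := by
    rw [successProb, ← lintegral_indicator_one (measurableSet_consensus b m)]
    refine lintegral_congr fun ω => ?_
    have : residual ω ∈ consensus b (adopt m (firstTicker ω) (firstTick ω).2) ↔
      ω ∈ consensus b m := (exists_evolve_const_iff b m ω).symm
    by_cases hω : ω ∈ consensus b m
    · rw [Set.indicator_of_mem hω, Set.indicator_of_mem (this.2 hω)]; rfl
    · rw [Set.indicator_of_notMem hω, Set.indicator_of_notMem (fun hc => hω (this.1 hc))]
  simp only at h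
  rw [hl] at h
  rw [h, Finset.mul_sum]
  refine Finset.sum_congr rfl fun n _ => ?_
  rw [lintegral_mul_const _ (measurable_discount lam N), ← mul_assoc, lintegral_discount, one_mul]

/-- Optional stopping for the success probability. -/
lemma lintegral_successProb_evolveUntil (b : Fin K) (l : ℕ) : ∀ (m : Fin N → Memory K) (T : ℝ),
    ∫⁻ ω, successProb lam μ p b (evolveUntil m ω T l) ∂law K N lam μ p =
      successProb lam μ p b m := by
  induction l with
  | zero => intro m T; simp [evolveUntil]
  | succ l ih =>
    intro m T
    set f : (Fin N → Memory K) → ℝ≥0∞ := successProb lam μ p b with hf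
    have hfm : Measurable f := Measurable.of_discrete
    set d : ℝ → ℝ≥0∞ := fun t => ENNReal.ofReal (Real.exp (-(lam * t))) ^ (N - 1) with hd
    have hdm : Measurable d := measurable_discount lam N
    set S : Set ℝ := Set.Iic T with hS
    have h := lintegral_step (K := K) (N := N) (lam := lam) (μ := μ) (p := p)
      (fun n t w => if t ≤ T then f (adopt m n w) else f m)
      (fun n => Measurable.ite (measurableSet_le measurable_fst measurable_const)
        ((Measurable.of_discrete (f := fun w => f (adopt m n w))).comp measurable_snd)
        measurable_const)
      (fun n q => if gap q.1 ≤ T then f (evolveUntil (adopt m n q.1.2) q.2 (T - gap q.1) l)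
        else f m)
      (fun n => by
        have hg : Measurable fun q : TickData K N × Sample K N => gap q.1 :=
          measurable_gap.comp measurable_fst
        have : Measurable fun q : Marks K N × (ℝ × Sample K N) =>
            f (evolveUntil (adopt m n q.1) q.2.2 q.2.1 l) :=
          measurable_from_prod_countable_right fun w => hfm.comp (measurable_evolveUntil l (adopt m n w))
        refine Measurable.ite (measurableSet_le hg measurable_const) ?_ measurable_const
        exact this.comp ((measurable_marks.comp measurable_fst).prodMk
          ((measurable_const.sub hg).prodMk measurable_snd)))
      (fun n z => by
        dsimp only
        split_ifs
        · exact ih _ _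
        · simp)
    have hl : ∀ ω : Sample K N, f (evolveUntil m ω T (l + 1)) = if gap (firstTick ω) ≤ T then
        f (evolveUntil (adopt m (firstTicker ω) (firstTick ω).2) (residual ω)
          (T - gap (firstTick ω)) l) else f m := by
      intro ω
      rw [evolveUntil]
      split_ifs <;> rfl
    simp_rw [hl]
    rw [h]
    -- Up to `T` the chain makes a step, after `T` it is frozen. Harmonicity makes both parts
    -- multiples of `f m`, and the two coefficients add up to `1`.
    have hterm : ∀ n, ∫⁻ t, d t * ∫⁻ w, (if t ≤ T then f (adopt m n w) else f m)
        ∂markLaw K N μ p ∂expMeasure lam =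
        (∫⁻ t in S, d t ∂expMeasure lam) * ∫⁻ w, f (adopt m n w) ∂markLaw K N μ p +
          (∫⁻ t in Sᶜ, d t ∂expMeasure lam) * f m := by
      intro n
      rw [← lintegral_add_compl _ measurableSet_Iic, ← lintegral_mul_const _ hdm,
        ← lintegral_mul_const _ hdm]
      congr 1
      · refine setLIntegral_congr_fun measurableSet_Iic fun t ht => ?_
        simp only [if_pos (show t ≤ T from ht)]
      · refine setLIntegral_congr_fun measurableSet_Iic.compl fun t ht => ?_
        simp only [if_neg (show ¬ t ≤ T from ht), lintegral_const, measure_univ, mul_one]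
    rw [Finset.sum_congr rfl fun n _ => hterm n, Finset.sum_add_distrib, ← Finset.mul_sum,
      successProb_harmonic, Finset.sum_const, Finset.card_univ, Fintype.card_fin, nsmul_eq_mul]
    have h1 : (N : ℝ≥0∞) * ((∫⁻ t in S, d t ∂expMeasure lam) + ∫⁻ t in Sᶜ, d t ∂expMeasure lam)
        = 1 := by
      rw [lintegral_add_compl _ measurableSet_Iic, lintegral_discount]
    calc _ = ((N : ℝ≥0∞) * ((∫⁻ t in S, d t ∂expMeasure lam) +
          ∫⁻ t in Sᶜ, d t ∂expMeasure lam)) * f m := by ring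
      _ = f m := by rw [h1, one_mul]

end Harmonic

/-! ### The potential and its mean change at one tick. -/

/-- The potential `r ^ #{n | m n = some b}`. -/
def weight (r : ℝ) (b : Fin K) (m : Fin N → Memory K) : ℝ :=
  ∏ n, if m n = some b then r else 1

section Weight

variable {r : ℝ} {b : Fin K} (m : Fin N → Memory K)

lemma weight_pos (hr : 0 < r) : 0 < weight r b m :=
  Finset.prod_pos fun n _ => by split_ifs <;> positivity

lemma weight_le_one (hr : 0 < r) (hr1 : r ≤ 1) : weight r b m ≤ 1 :=
  Finset.prod_le_one (fun n _ => by split_ifs <;> positivity) fun n _ => by split_ifs <;> simp [hr1]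

/-- The factor of the old memory of `n` is exchanged for that of the new one; keeping it on the left
avoids dividing by it. -/
lemma weight_update (n : Fin N) (x : Memory K) :
    weight r b (Function.update m n x) * (if m n = some b then r else 1) =
      weight r b m * if x = some b then r else 1 := by
  unfold weight
  rw [← Finset.mul_prod_erase _ _ (Finset.mem_univ n),
    ← Finset.mul_prod_erase _ (fun n => if m n = some b then r else 1) (Finset.mem_univ n),
    Function.update_self, Finset.prod_congr rfl fun i hi => by
      rw [Function.update_of_ne (Finset.ne_of_mem_erase hi)]]
  ring

end Weight

lemma adopt_eq_of_pick_none {m : Fin N → Memory K} {n : Fin N} {w : Marks K N}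
    (h : pick m n w = none) : adopt m n w = m := by
  simp only [adopt, refine]
  rw [show choose m n (0, w) = none from h]

lemma adopt_eq_of_pick_some {m : Fin N → Memory K} {n : Fin N} {w : Marks K N} {k : Fin K}
    (h : pick m n w = some k) :
    adopt m n w = if w.2.2.2 k then Function.update m n (some k) else m := by
  simp only [adopt, refine]
  rw [show choose m n (0, w) = some k from h]
  rfl

lemma pick_of_ne_none {m : Fin N → Memory K} {n : Fin N} {w : Marks K N} (h : m n ≠ none) :
    pick m n w = m w.2.2.1 := by
  obtain ⟨k, hk⟩ := Option.ne_none_iff_exists'.1 h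
  simp [pick, choose, hk, peer]

section Rewards

variable {p : Fin K → I}

lemma measure_reward (k : Fin K) :
    (Measure.pi fun k => bernoulliMeasure true false (p k)) {ρ | ρ k = true} =
      ENNReal.ofReal (p k) := by
  have := (measurePreserving_eval (fun k => bernoulliMeasure true false (p k)) k).measure_preimage
    (measurableSet_singleton (α := Bool) true).nullMeasurableSet
  have h : Function.eval k ⁻¹' ({true} : Set Bool) = {ρ : Fin K → Bool | ρ k = true} := by ext; simp
  rw [← h, this, bernoulliMeasure_apply_of_mem_of_notMem _ (measurableSet_singleton _) rfl (by simp)]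
  rw [ENNReal.ofReal, Real.toNNReal_of_nonneg (p k).2.1]
  rfl

lemma integral_reward (k : Fin K) (f : Bool → ℝ) :
    ∫ ρ, f (ρ k) ∂(Measure.pi fun k => bernoulliMeasure true false (p k)) =
      p k * f true + (1 - p k) * f false := by
  have h := (measurePreserving_eval (fun k => bernoulliMeasure true false (p k)) k)
  have h2 := integral_map (μ := Measure.pi fun k => bernoulliMeasure true false (p k))
    (φ := Function.eval k) (f := f) h.measurable.aemeasurable
    (Measurable.of_discrete).aestronglyMeasurable
  rw [h.map_eq, integral_bernoulliMeasure] at h2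
  simpa using h2.symm

/-- `1` if `n` prefers `b`. -/
def isFor (b : Fin K) (m : Fin N → Memory K) (n : Fin N) : ℝ := if m n = some b then 1 else 0

/-- `1` if `n` prefers an arm other than `b`. -/
def isAgainst (b : Fin K) (m : Fin N → Memory K) (n : Fin N) : ℝ :=
  if m n ≠ none ∧ m n ≠ some b then 1 else 0

variable {b : Fin K} {s : ℝ}

/-- The drift is bounded by a quantity antisymmetric in ticker `n` and peer `q`, so that it vanishes
when summed over both. The ratio `s / p b` is the one for which `s * (1 / r - 1) = p b * (1 - r)`,
balancing the worst loss of a supporter of `b` against the recruitment of an opponent. -/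
lemma integral_weight_adopt_le (hs : 0 < s) (hsb : s < p b) (hp : ∀ k, k ≠ b → p k ≤ s)
    (m : Fin N → Memory K) (n : Fin N) (e : Bool) (a : Fin K) (q : Fin N) :
    ∫ ρ, weight (s / p b) b (adopt m n (e, a, q, ρ))
        ∂(Measure.pi fun k => bernoulliMeasure true false (p k)) ≤
      weight (s / p b) b m *
        (1 + (p b - s) * (isFor b m n * isAgainst b m q - isAgainst b m n * isFor b m q)) := by
  have hpb : (0 : ℝ) < p b := hs.trans hsb
  set r : ℝ := s / p b with hr
  have hr0 : 0 < r := div_pos hs hpb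
  have hr1 : r ≤ 1 := (div_le_one hpb).2 hsb.le
  have hrp : p b * r = s := by rw [hr]; field_simp
  have hW := weight_pos (b := b) m hr0
  set W := weight r b m with hWdef
  rcases hc : pick m n (e, a, q, fun _ => false) with _ | k
  · have h1 : ∀ ρ, adopt m n (e, a, q, ρ) = m := fun ρ => adopt_eq_of_pick_none hc
    simp only [h1, integral_const, smul_eq_mul, probReal_univ, one_mul, ← hWdef]
    have hz : isFor b m n * isAgainst b m q - isAgainst b m n * isFor b m q = 0 := by
      by_cases hn : m n = none
      · simp [isFor, isAgainst, hn]
      · rw [pick_of_ne_none hn] at hc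
        change m q = none at hc
        simp [isFor, isAgainst, hc]
    rw [hz]; simp
  · have h1 : ∀ ρ, weight r b (adopt m n (e, a, q, ρ)) =
        (fun x : Bool => if x then weight r b (Function.update m n (some k)) else W) (ρ k) := by
      intro ρ
      rw [adopt_eq_of_pick_some (w := (e, a, q, ρ)) hc]
      dsimp only
      split_ifs <;> rfl
    rw [integral_congr_ae (ae_of_all _ h1),
      integral_reward k fun x => if x then weight r b (Function.update m n (some k)) else W]
    simp only [if_true, Bool.false_eq_true, if_false]
    have hu := weight_update (r := r) (b := b) m n (some k)
    rw [← hWdef] at hu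
    set U := weight r b (Function.update m n (some k))
    have hk0 : (0 : ℝ) ≤ p k := (p k).2.1
    -- Without a preference there is no supporter of `b` to lose: the potential can only drop.
    by_cases hn : m n = none
    · have hz : isFor b m n * isAgainst b m q - isAgainst b m n * isFor b m q = 0 := by
        simp [isFor, isAgainst, hn]
      have hUW : U ≤ W := by
        simp only [hn, reduceCtorEq, if_false, mul_one] at hu
        rw [hu]
        split_ifs
        · exact mul_le_of_le_one_right hW.le hr1
        · simp
      rw [hz]
      nlinarith
    · rw [pick_of_ne_none hn] at hc
      change m q = some k at hc
      by_cases hnb : m n = some b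
      · by_cases hkb : k = b
        · simp only [hnb, hkb, if_true] at hu
          have hUW : U = W := mul_right_cancel₀ hr0.ne' hu
          simp [isFor, isAgainst, hc, hnb, hkb, hUW]
          linarith
        · simp only [hnb, if_true, Option.some.injEq, hkb, if_false, mul_one] at hu
          simp only [isFor, isAgainst, hc, hnb, Option.some.injEq, hkb, if_true, if_false,
            ne_eq, reduceCtorEq, not_false_iff, not_true_eq_false, and_false, and_self, mul_one,
            mul_zero, sub_zero]
          have hUW : W ≤ U := by
            rw [← hu]
            exact mul_le_of_le_one_right (weight_pos _ hr0).le hr1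
          have h2 : (p k : ℝ) * (U - W) ≤ s * (U - W) :=
            mul_le_mul_of_nonneg_right (hp k hkb) (by linarith)
          have h3 : s * U = p b * W := by rw [← hrp, ← hu]; ring
          nlinarith
      · simp only [hnb, if_false, mul_one] at hu
        by_cases hkb : k = b
        · subst hkb
          simp only [if_true] at hu
          have h4 : isFor k m n * isAgainst k m q - isAgainst k m n * isFor k m q = -1 := by
            simp [isFor, isAgainst, hc, hnb, hn]
          rw [h4, hu]
          have : (p k : ℝ) * (W * r) = W * s := by rw [← hrp]; ring
          nlinarith
        · have h4 : isFor b m n * isAgainst b m q - isAgainst b m n * isFor b m q = 0 := by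
            simp [isFor, hc, hnb, hkb]
          simp only [Option.some.injEq, hkb, if_false, mul_one] at hu
          rw [h4, hu]
          nlinarith

end Rewards

lemma uniformOn_univ_fin_singleton {n : ℕ} (a : Fin n) :
    uniformOn (Set.univ : Set (Fin n)) {a} = (n : ℝ≥0∞)⁻¹ := by
  rw [uniformOn_univ]
  simp

lemma integral_uniformOn_univ_fin {n : ℕ} [NeZero n] (f : Fin n → ℝ) :
    ∫ a, f a ∂uniformOn (Set.univ : Set (Fin n)) = (n : ℝ)⁻¹ * ∑ a, f a := by
  have := isProbabilityMeasure_uniformOn_univ_fin n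
  rw [integral_fintype Integrable.of_finite, Finset.mul_sum]
  refine Finset.sum_congr rfl fun a _ => ?_
  rw [measureReal_def, uniformOn_univ_fin_singleton]
  simp

/-! ### Supermartingale property and maximum principle. -/

section Chain

variable [NeZero K] [NeZero N] {lam : ℝ} [hlam : Fact (0 < lam)] {μ : I} {p : Fin K → I}
  {b : Fin K} {s : ℝ}

/-- The potential is a supermartingale. -/
lemma sum_integral_weight_adopt_le (hs : 0 < s) (hsb : s < p b) (hp : ∀ k, k ≠ b → p k ≤ s)
    (m : Fin N → Memory K) :
    ∑ n, ∫ w, weight (s / p b) b (adopt m n w) ∂markLaw K N μ p ≤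
      N * weight (s / p b) b m := by
  have := isProbabilityMeasure_uniformOn_univ_fin K
  have := isProbabilityMeasure_uniformOn_univ_fin N
  set W := weight (s / p b) b m with hW
  have hN : (N : ℝ) ≠ 0 := Nat.cast_ne_zero.2 (NeZero.ne N)
  set h : Fin N → Fin N → ℝ := fun n q =>
    isFor b m n * isAgainst b m q - isAgainst b m n * isFor b m q with hh
  have hstep : ∀ n, ∫ w, weight (s / p b) b (adopt m n w) ∂markLaw K N μ p ≤
      (N : ℝ)⁻¹ * ∑ q, W * (1 + (p b - s) * h n q) := by
    intro n
    unfold markLaw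
    rw [integral_prod _ Integrable.of_finite, ← integral_uniformOn_univ_fin]
    set R := ∫ q, W * (1 + (p b - s) * h n q) ∂uniformOn (Set.univ : Set (Fin N)) with hR
    have h1 : ∀ e a, ∫ y, weight (s / p b) b (adopt m n (e, a, y))
        ∂(uniformOn (Set.univ : Set (Fin N))).prod
          (Measure.pi fun k => bernoulliMeasure true false (p k)) ≤ R := by
      intro e a
      rw [integral_prod _ Integrable.of_finite]
      exact integral_mono Integrable.of_finite Integrable.of_finite fun q =>
        integral_weight_adopt_le hs hsb hp m n e a q
    have h2 : ∀ e, ∫ y, weight (s / p b) b (adopt m n (e, y))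
        ∂(uniformOn (Set.univ : Set (Fin K))).prod ((uniformOn (Set.univ : Set (Fin N))).prod
          (Measure.pi fun k => bernoulliMeasure true false (p k))) ≤ R := by
      intro e
      rw [integral_prod _ Integrable.of_finite]
      refine (integral_mono (g := fun _ => R) Integrable.of_finite Integrable.of_finite fun a =>
        h1 e a).trans ?_
      simp
    refine (integral_mono (g := fun _ => R) Integrable.of_finite Integrable.of_finite fun e =>
      h2 e).trans ?_
    simp
  -- Antisymmetry: exchanging ticker and peer changes the sign.
  have hanti : ∑ n, ∑ q, h n q = 0 := by
    simp only [hh, Finset.sum_sub_distrib]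
    rw [sub_eq_zero]
    conv_rhs => rw [Finset.sum_comm]
    exact Finset.sum_congr rfl fun n _ => Finset.sum_congr rfl fun q _ => mul_comm _ _
  calc _ ≤ ∑ n, (N : ℝ)⁻¹ * ∑ q, W * (1 + (p b - s) * h n q) :=
        Finset.sum_le_sum fun n _ => hstep n
    _ = (N : ℝ)⁻¹ * W * (N * N + (p b - s) * ∑ n, ∑ q, h n q) := by
        simp only [← Finset.mul_sum, Finset.sum_add_distrib, Finset.sum_const, Finset.card_univ,
          Fintype.card_fin, nsmul_eq_mul, mul_one]
        ring
    _ = N * W := by rw [hanti]; field_simp; ring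

lemma markLaw_discovers_peer (b : Fin K) (Q : Set (Fin N)) :
    markLaw K N μ p ({true} ×ˢ {b} ×ˢ Q ×ˢ {ρ | ρ b = true}) =
      ENNReal.ofReal μ * ((K : ℝ≥0∞)⁻¹ *
        (uniformOn (Set.univ : Set (Fin N)) Q * ENNReal.ofReal (p b))) := by
  have := isProbabilityMeasure_uniformOn_univ_fin K
  have := isProbabilityMeasure_uniformOn_univ_fin N
  rw [markLaw, Measure.prod_prod, Measure.prod_prod, Measure.prod_prod, measure_reward,
    uniformOn_univ_fin_singleton,
    bernoulliMeasure_apply_of_mem_of_notMem _ (measurableSet_singleton _) rfl (by simp),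
    show ENNReal.ofReal μ = unitInterval.toNNReal μ by
      rw [ENNReal.ofReal, Real.toNNReal_of_nonneg μ.2.1]; rfl]

/-- The failure probability is bounded by the potential. -/
theorem one_sub_successProb_le_weight (hμ : 0 < μ) (hs : 0 < s) (hsb : s < p b)
    (hp : ∀ k, k ≠ b → p k ≤ s) (m : Fin N → Memory K) :
    1 - (successProb lam μ p b m).toReal ≤ weight (s / p b) b m := by
  have hpb : (0 : ℝ) < p b := hs.trans hsb
  set r : ℝ := s / p b with hr
  have hr0 : 0 < r := div_pos hs hpb
  have hr1 : r < 1 := (div_lt_one hpb).2 hsb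
  -- A harmonic function minus a superharmonic one, hence subharmonic. A positive maximum has to be
  -- excluded; no proof that some consensus is eventually reached is needed.
  set f : (Fin N → Memory K) → ℝ := fun m =>
    1 - (successProb lam μ p b m).toReal - weight r b m with hf
  suffices ∀ m, f m ≤ 0 by have := this m; simp only [hf] at this; linarith
  by_contra! hcon
  obtain ⟨m₀, hm₀⟩ := hcon
  obtain ⟨m₁, hm₁⟩ := Finite.exists_max f
  -- Among the maximizers of `f`, one of least weight: a reachable maximizer with one more supporter
  -- of `b` will give a contradiction.
  obtain ⟨m, hm, hmin⟩ := Finset.exists_min_image (Finset.univ.filter fun m => f m = f m₁)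
    (weight r b) ⟨m₁, by simp⟩
  have hmax : ∀ m', f m' ≤ f m := by
    intro m'
    rw [(Finset.mem_filter.1 hm).2]
    exact hm₁ m'
  have hpos : 0 < f m := hm₀.trans_le (hmax m₀)
  have hsub : N * f m ≤ ∑ n, ∫ w, f (adopt m n w) ∂markLaw K N μ p := by
    have h1 := sum_integral_weight_adopt_le (μ := μ) hs hsb hp m
    have h2 : ∑ n, ∫ w, (successProb lam μ p b (adopt m n w)).toReal ∂markLaw K N μ p =
        N * (successProb lam μ p b m).toReal := by
      have h3 := congrArg ENNReal.toReal (successProb_harmonic (lam := lam) (μ := μ) (p := p) b m)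
      have hle : ∀ n, ∫⁻ w, successProb lam μ p b (adopt m n w) ∂markLaw K N μ p ≠ ∞ := by
        intro n
        refine ne_top_of_le_ne_top (b := 1) (by simp) ?_
        calc _ ≤ ∫⁻ w, 1 ∂markLaw K N μ p := lintegral_mono fun w => prob_le_one
          _ = 1 := by simp
      rw [ENNReal.toReal_sum fun n _ => hle n, ENNReal.toReal_mul, ENNReal.toReal_natCast] at h3
      rw [← h3]
      refine Finset.sum_congr rfl fun n _ => ?_
      rw [integral_toReal (f := fun w => successProb lam μ p b (adopt m n w))
        (Measurable.of_discrete).aemeasurable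
        (ae_of_all _ fun w => measure_lt_top _ _)]
    have h4 : ∀ n, ∫ w, f (adopt m n w) ∂markLaw K N μ p =
        1 - ∫ w, (successProb lam μ p b (adopt m n w)).toReal ∂markLaw K N μ p -
          ∫ w, weight r b (adopt m n w) ∂markLaw K N μ p := by
      intro n
      simp only [hf]
      rw [integral_sub Integrable.of_finite Integrable.of_finite,
        integral_sub Integrable.of_finite Integrable.of_finite]
      simp
    simp only [h4, Finset.sum_sub_distrib, h2, Finset.sum_const, Finset.card_univ,
      Fintype.card_fin, nsmul_eq_mul, mul_one]
    simp only [hf]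
    linarith
  -- Without supporters of `b` the weight is `1`, and with only supporters the success probability
  -- is `1`; either way `f m ≤ 0`.
  have hex : ∃ q, m q = some b := by
    by_contra! hno
    have : weight r b m = 1 := by simp [weight, hno]
    simp only [hf, this] at hpos
    have := ENNReal.toReal_nonneg (a := successProb lam μ p b m)
    linarith
  have hex' : ∃ n, m n ≠ some b := by
    by_contra! hall
    have h1 : m = fun _ => some b := funext hall
    have h2 : successProb lam μ p b m = 1 := by
      rw [successProb, h1, consensus]
      convert measure_univ (μ := law K N lam μ p)
      ext ω
      simp [evolve_const]
    simp only [hf, h2, ENNReal.toReal_one] at hpos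
    have := weight_pos (b := b) m hr0
    linarith
  obtain ⟨q, hq⟩ := hex
  obtain ⟨n, hn⟩ := hex'
  have hint : f m ≤ ∫ w, f (adopt m n w) ∂markLaw K N μ p := by
    have hle : ∀ n, ∫ w, f (adopt m n w) ∂markLaw K N μ p ≤ f m := by
      intro n
      refine (integral_mono (g := fun _ => f m) Integrable.of_finite Integrable.of_finite
        fun w => hmax _).trans ?_
      simp
    by_contra! hlt
    have : ∑ n, ∫ w, f (adopt m n w) ∂markLaw K N μ p < ∑ _n : Fin N, f m :=
      Finset.sum_lt_sum (fun n _ => hle n) ⟨n, Finset.mem_univ _, hlt⟩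
    simp only [Finset.sum_const, Finset.card_univ, Fintype.card_fin, nsmul_eq_mul] at this
    linarith
  -- A mean of values at most `f m` that is at least `f m` forces equality almost everywhere.
  have hae : ∀ᵐ w ∂markLaw K N μ p, f m - f (adopt m n w) = 0 := by
    refine (integral_eq_zero_iff_of_nonneg (fun w => sub_nonneg.2 (hmax _))
      Integrable.of_finite).1 (le_antisymm ?_ (integral_nonneg fun w => sub_nonneg.2 (hmax _)))
    rw [integral_sub Integrable.of_finite Integrable.of_finite]
    simpa using hint
  -- These marks convert `n` to `b` in every case: without a preference it explores `b`, otherwise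
  -- it copies `q`. They have positive probability.
  have hnull : markLaw K N μ p ({true} ×ˢ {b} ×ˢ {q} ×ˢ {ρ | ρ b = true}) = 0 := by
    refine measure_mono_null ?_ (ae_iff.1 hae)
    rintro ⟨e, a, q', ρ⟩ ⟨he, ha, hq', hρ⟩
    obtain rfl : e = true := he
    obtain rfl : a = b := ha
    obtain rfl : q' = q := hq'
    have hρ' : ρ a = true := hρ
    have hadopt : adopt m n (true, a, q', ρ) = Function.update m n (some a) := by
      have hpick : pick m n (true, a, q', ρ) = some a := by
        by_cases hnn : m n = none
        · simp [pick, choose, hnn, explore, uniformArm]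
        · rw [pick_of_ne_none hnn]; exact hq
      rw [adopt_eq_of_pick_some hpick]
      simp [hρ']
    intro heq
    change f m - f (adopt m n (true, a, q', ρ)) = 0 at heq
    rw [hadopt] at heq
    have hu := weight_update (r := r) (b := a) m n (some a)
    simp only [hn, if_false, if_true, mul_one] at hu
    have h1 := hmin (Function.update m n (some a)) (by
      simp only [Finset.mem_filter, Finset.mem_univ, true_and]
      rw [← (Finset.mem_filter.1 hm).2]; linarith)
    rw [hu] at h1
    have := weight_pos (b := a) m hr0
    nlinarith
  rw [markLaw_discovers_peer, uniformOn_univ_fin_singleton] at hnull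
  have hμ' : (0 : ℝ) < μ := hμ
  simp [ENNReal.ofReal_eq_zero, not_le.2 hμ', not_le.2 hpb] at hnull

end Chain

/-! ### Early discoveries and control of the clocks. -/

/-- Some clock has ticked more than `J` times by time `t`. -/
def fastClock (t : ℝ) (J : ℕ) : Set (Sample K N) := {ω | ∃ n, tickTime ω n J ≤ t}

lemma measurable_tickTime (n : Fin N) (j : ℕ) :
    Measurable fun ω : Sample K N => tickTime ω n j :=
  Finset.measurable_sum _ fun _ _ => measurable_gap.comp (measurable_pi_apply _)

lemma measurableSet_fastClock (t : ℝ) (J : ℕ) :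
    MeasurableSet (fastClock t J : Set (Sample K N)) := by
  simp only [fastClock, Set.ofPred_exists]
  exact MeasurableSet.iUnion fun n => measurableSet_le (measurable_tickTime n J) measurable_const

/-- An individual ticks exactly once up to time `t`, and discovers `b` at that tick. -/
def discovery (b : Fin K) (t : ℝ) : Set (ℕ → TickData K N) :=
  {x | (gap (x 0) ≤ t ∧ t < gap (x 0) + gap (x 1)) ∧ Discovers b (x 0).2}

lemma measurableSet_discovers (b : Fin K) : MeasurableSet {w : Marks K N | Discovers b w} :=
  MeasurableSet.of_discrete

lemma measurableSet_discovery (b : Fin K) (t : ℝ) :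
    MeasurableSet (discovery b t : Set (ℕ → TickData K N)) := by
  have h0 : Measurable fun x : ℕ → TickData K N => gap (x 0) :=
    measurable_gap.comp (measurable_pi_apply _)
  have h1 : Measurable fun x : ℕ → TickData K N => gap (x 1) :=
    measurable_gap.comp (measurable_pi_apply _)
  exact ((measurableSet_le h0 measurable_const).inter
    (measurableSet_lt measurable_const (h0.add h1))).inter
    ((measurable_marks.comp (measurable_pi_apply 0)) (measurableSet_discovers b))

section Clocks

variable [NeZero K] [NeZero N] {lam : ℝ} [hlam : Fact (0 < lam)] {μ : I} {p : Fin K → I}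

lemma expMeasure_Ioi {t : ℝ} (ht : 0 ≤ t) :
    expMeasure lam (Set.Ioi t) = ENNReal.ofReal (Real.exp (-(lam * t))) := by
  have h := congrArg (fun ν => ν Set.univ) (map_sub_restrict_expMeasure (lam := lam) ht True)
  simpa [Measure.map_apply (show Measurable fun x : ℝ => x - t by fun_prop) .univ] using h

lemma expMeasure_Iic_lt_one {t : ℝ} (ht : 0 ≤ t) : expMeasure lam (Set.Iic t) < 1 := by
  rw [← Set.compl_Ioi, prob_compl_eq_one_sub measurableSet_Ioi, expMeasure_Ioi ht]
  exact ENNReal.sub_lt_self (by simp) (by simp) (by simp [Real.exp_pos])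

lemma law_forall_gap_le (n : Fin N) (t : ℝ) (J : ℕ) :
    law K N lam μ p {ω | ∀ j ≤ J, gap (ω (n, j)) ≤ t} = expMeasure lam (Set.Iic t) ^ (J + 1) := by
  have h : {ω : Sample K N | ∀ j ≤ J, gap (ω (n, j)) ≤ t} =
      Set.pi (↑((Finset.range (J + 1)).image fun j => (n, j)) : Set (Fin N × ℕ))
        fun _ => Set.Iic t ×ˢ Set.univ := by
    ext ω
    simp [Set.mem_pi, gap]
  rw [h, law, Measure.infinitePi_pi _ fun i _ => measurableSet_Iic.prod .univ, Finset.prod_const,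
    Finset.card_image_of_injective _ (fun a b h => by simpa using h), Finset.card_range,
    tickLaw_eq_prod, Measure.prod_prod, measure_univ, mul_one]

lemma ae_gap_nonneg_law : ∀ᵐ ω ∂law K N lam μ p, ∀ i, 0 ≤ gap (ω i) :=
  ae_all_iff.2 fun i =>
    (measurePreserving_eval_infinitePi (fun _ : Fin N × ℕ => tickLaw K N lam μ p)
      i).quasiMeasurePreserving.ae (ae_gap_nonneg lam μ p)

lemma ae_exists_lt_gap :
    ∀ᵐ ω ∂law K N lam μ p, ∀ n (t : ℝ), ∃ j, t < gap (ω (n, j)) := by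
  have h : ∀ᵐ ω ∂law K N lam μ p, ∀ n (t : ℕ), ∃ j, (t : ℝ) < gap (ω (n, j)) := by
    refine ae_all_iff.2 fun n => ae_all_iff.2 fun t => ?_
    have hlim := ENNReal.tendsto_pow_atTop_nhds_zero_of_lt_one
      (expMeasure_Iic_lt_one (lam := lam) (Nat.cast_nonneg t))
    refine le_antisymm (ge_of_tendsto' ((tendsto_add_atTop_iff_nat 1).2 hlim) fun J => ?_) bot_le
    rw [← law_forall_gap_le (K := K) (μ := μ) (p := p) n t J]
    refine measure_mono fun ω hω j _ => ?_
    have hω' : ¬ ∃ j, (t : ℝ) < gap (ω (n, j)) := hω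
    push Not at hω'
    exact hω' j
  filter_upwards [h] with ω hω n t
  obtain ⟨k, hk⟩ := exists_nat_ge t
  obtain ⟨j, hj⟩ := hω n k
  exact ⟨j, hk.trans_lt hj⟩

/-- If tick number `J`, counted from `0`, occurs by `t`, then each of the `J + 1` gaps before it is
at most `t`. This crude geometric bound suffices, since `J` will tend to infinity. -/
lemma law_fastClock_le (t : ℝ) (J : ℕ) :
    law K N lam μ p (fastClock t J) ≤ N * expMeasure lam (Set.Iic t) ^ (J + 1) := by
  calc law K N lam μ p (fastClock t J)
      ≤ law K N lam μ p (⋃ n : Fin N, {ω | ∀ j ≤ J, gap (ω (n, j)) ≤ t}) := by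
        refine measure_mono_ae ?_
        filter_upwards [ae_gap_nonneg_law] with ω hpos
        rintro ⟨n, hn⟩
        refine Set.mem_iUnion.2 ⟨n, fun j hj => le_trans ?_ hn⟩
        exact Finset.single_le_sum (f := fun i => gap (ω (n, i))) (fun i _ => hpos _)
          (Finset.mem_range.2 (Nat.lt_succ_of_le hj))
    _ ≤ ∑ n : Fin N, law K N lam μ p {ω | ∀ j ≤ J, gap (ω (n, j)) ≤ t} :=
        measure_iUnion_fintype_le _ _
    _ = N * expMeasure lam (Set.Iic t) ^ (J + 1) := by simp [law_forall_gap_le]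

/-- The Poisson probability of exactly one tick in `[0, t]`: first tick at `g`, next gap longer than
`t - g`. The integrand is constant on `[0, t]`. -/
lemma lintegral_expMeasure_one_tick (t : ℝ) :
    ∫⁻ g in Set.Iic t, ENNReal.ofReal (Real.exp (-(lam * (t - g)))) ∂expMeasure lam =
      ENNReal.ofReal (lam * t * Real.exp (-(lam * t))) := by
  have hm : Measurable fun g : ℝ => ENNReal.ofReal (Real.exp (-(lam * (t - g)))) := by fun_prop
  rw [expMeasure_eq_withDensity, setLIntegral_withDensity_eq_setLIntegral_mul _
    (measurable_exponentialPDF lam) hm measurableSet_Iic, ← lintegral_indicator measurableSet_Iic]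
  have h : ∀ g, (Set.Iic t).indicator (exponentialPDF lam *
      fun g => ENNReal.ofReal (Real.exp (-(lam * (t - g))))) g =
      (Set.Icc 0 t).indicator (fun _ => ENNReal.ofReal (lam * Real.exp (-(lam * t)))) g := by
    intro g
    by_cases h0 : 0 ≤ g
    · by_cases h1 : g ≤ t
      · rw [Set.indicator_of_mem (show g ∈ Set.Iic t from h1),
          Set.indicator_of_mem (show g ∈ Set.Icc 0 t from ⟨h0, h1⟩), Pi.mul_apply,
          exponentialPDF_of_nonneg h0, ← ENNReal.ofReal_mul
            (mul_nonneg hlam.out.le (Real.exp_pos _).le), mul_assoc, ← Real.exp_add]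
        ring_nf
      · rw [Set.indicator_of_notMem (show g ∉ Set.Iic t from h1),
          Set.indicator_of_notMem (show g ∉ Set.Icc 0 t from fun h => h1 h.2)]
    · rw [Set.indicator_of_notMem (show g ∉ Set.Icc 0 t from fun h => h0 h.1)]
      refine Set.indicator_apply_eq_zero.2 fun _ => ?_
      rw [Pi.mul_apply, exponentialPDF_of_neg (not_le.1 h0), zero_mul]
  rw [lintegral_congr h, lintegral_indicator measurableSet_Icc, setLIntegral_const,
    Real.volume_Icc, ← ENNReal.ofReal_mul (mul_nonneg hlam.out.le (Real.exp_pos _).le)]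
  congr 1
  ring

lemma markLaw_discovers (b : Fin K) :
    markLaw K N μ p {w | Discovers b w} = ENNReal.ofReal (μ * p b / K) := by
  have : {w : Marks K N | Discovers b w} =
      {true} ×ˢ {b} ×ˢ Set.univ ×ˢ {ρ : Fin K → Bool | ρ b = true} := by
    ext ⟨e, a, q, ρ⟩
    simp [Discovers]
  have := isProbabilityMeasure_uniformOn_univ_fin N
  rw [‹{w : Marks K N | Discovers b w} = _›, markLaw_discovers_peer, measure_univ, one_mul,
    mul_div_right_comm, ENNReal.ofReal_mul (div_nonneg μ.2.1 (Nat.cast_nonneg K)),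
    ENNReal.ofReal_div_of_pos (Nat.cast_pos.2 (NeZero.pos K)), ENNReal.ofReal_natCast, ← mul_assoc,
    ENNReal.div_eq_inv_mul, mul_comm (_⁻¹)]

lemma infinitePi_discovery (b : Fin K) (t : ℝ) :
    Measure.infinitePi (fun _ : ℕ => tickLaw K N lam μ p) (discovery b t) =
      ENNReal.ofReal (μ * p b / K * (lam * t * Real.exp (-(lam * t)))) := by
  set D : Set (TickData K N × TickData K N) :=
    {z | (gap z.1 ≤ t ∧ t < gap z.1 + gap z.2) ∧ Discovers b z.1.2} with hD
  have hg1 : Measurable fun z : TickData K N × TickData K N => gap z.1 :=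
    measurable_gap.comp measurable_fst
  have hg2 : Measurable fun z : TickData K N × TickData K N => gap z.2 :=
    measurable_gap.comp measurable_snd
  have hDm : MeasurableSet D := ((measurableSet_le hg1 measurable_const).inter
    (measurableSet_lt measurable_const (hg1.add hg2))).inter
    ((measurable_marks.comp measurable_fst) (measurableSet_discovers b))
  have hpre : discovery b t = (fun x : ℕ → TickData K N => (x 0, x 1)) ⁻¹' D := rfl
  rw [hpre, ← Measure.map_apply (by fun_prop) hDm, Measure.infinitePi_map_eval_prod zero_ne_one,
    Measure.prod_apply hDm]
  have hsec : ∀ z : TickData K N, tickLaw K N lam μ p (Prod.mk z ⁻¹' D) =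
      (Set.Iic t).indicator (fun g => ENNReal.ofReal (Real.exp (-(lam * (t - g))))) z.1 *
        {w : Marks K N | Discovers b w}.indicator 1 z.2 := by
    intro z
    by_cases hz : z.1 ≤ t
    · by_cases hw : Discovers b z.2
      · have : Prod.mk z ⁻¹' D = Set.Ioi (t - gap z) ×ˢ Set.univ := by
          ext z'
          have h1 : gap z ≤ t := hz
          simp only [hD, Set.mem_preimage, Set.mem_ofPred_eq, h1, hw, true_and, and_true,
            Set.mem_prod, Set.mem_Ioi, Set.mem_univ, sub_lt_iff_lt_add']
          rfl
        rw [this, tickLaw_eq_prod, Measure.prod_prod, measure_univ, mul_one,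
          expMeasure_Ioi (t := t - gap z) (sub_nonneg.2 hz), Set.indicator_of_mem (show z.1 ∈ Set.Iic t from hz),
          Set.indicator_of_mem (show z.2 ∈ {w | Discovers b w} from hw), Pi.one_apply, mul_one]
        rfl
      · rw [Set.indicator_of_notMem (show z.2 ∉ {w | Discovers b w} from hw), mul_zero]
        convert measure_empty (μ := tickLaw K N lam μ p)
        ext z'
        simp [hD, hw]
    · rw [Set.indicator_of_notMem (show z.1 ∉ Set.Iic t from hz), zero_mul]
      convert measure_empty (μ := tickLaw K N lam μ p)
      ext z'
      simp [hD, gap, hz]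
  have hf : Measurable ((Set.Iic t).indicator
      fun g => ENNReal.ofReal (Real.exp (-(lam * (t - g))))) :=
    Measurable.indicator (by fun_prop) measurableSet_Iic
  have hd : Measurable ({w : Marks K N | Discovers b w}.indicator (1 : Marks K N → ℝ≥0∞)) :=
    measurable_one.indicator (measurableSet_discovers b)
  rw [lintegral_congr hsec]
  conv_lhs => rw [tickLaw_eq_prod]
  rw [lintegral_prod_mul hf.aemeasurable hd.aemeasurable,
    lintegral_indicator measurableSet_Iic, lintegral_expMeasure_one_tick t,
    lintegral_indicator_one (measurableSet_discovers b), markLaw_discovers, mul_comm,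
    ← ENNReal.ofReal_mul (div_nonneg (mul_nonneg μ.2.1 (p b).2.1) (Nat.cast_nonneg K))]

open Classical in
/-- The discoveries of the individuals are independent. -/
lemma integral_prod_discovery (b : Fin K) {t : ℝ} (ht : 0 ≤ t) (r : ℝ) :
    ∫ ω, ∏ n, (if (fun j => ω (n, j)) ∈ (discovery b t : Set (ℕ → TickData K N)) then r else 1)
        ∂law K N lam μ p =
      (1 - μ * p b / K * (lam * t * Real.exp (-(lam * t))) * (1 - r)) ^ N := by
  set g : (ℕ → TickData K N) → ℝ := fun x => if x ∈ discovery b t then r else 1 with hg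
  have hgm : Measurable g := Measurable.ite (measurableSet_discovery b t) measurable_const
    measurable_const
  set P := Measure.infinitePi (fun _ : ℕ => tickLaw K N lam μ p) with hP
  -- Grouping the ticks by individual exhibits the sample as `N` independent sequences.
  have hmap : (law K N lam μ p).map (MeasurableEquiv.curry (Fin N) ℕ (TickData K N)) =
      Measure.pi fun _ : Fin N => P := by
    rw [law, Measure.infinitePi_map_curry fun _ _ => tickLaw K N lam μ p, Measure.infinitePi_eq_pi]
  have h1 : ∫ ω, ∏ n, g (fun j => ω (n, j)) ∂law K N lam μ p =
      ∫ y, ∏ n, g (y n) ∂Measure.pi fun _ : Fin N => P := by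
    rw [← hmap, integral_map (MeasurableEquiv.measurable _).aemeasurable]
    · rfl
    · exact (Finset.measurable_prod _ fun n _ =>
        hgm.comp (measurable_pi_apply n)).aestronglyMeasurable
  have h2 : ∫ x, g x ∂P = 1 - μ * p b / K * (lam * t * Real.exp (-(lam * t))) * (1 - r) := by
    have h3 : ∀ x, g x = 1 - (discovery b t).indicator (fun _ => 1 - r) x := by
      intro x
      simp only [hg, Set.indicator]
      split_ifs <;> ring
    simp_rw [h3]
    rw [integral_sub (integrable_const _)
      ((integrable_const _).indicator (measurableSet_discovery b t)),
      integral_indicator_const _ (measurableSet_discovery b t), measureReal_def, hP,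
      infinitePi_discovery b t, ENNReal.toReal_ofReal]
    · simp
    · have := hlam.out
      have := μ.2.1
      have := (p b).2.1
      positivity
  rw [h1, integral_fintype_prod_eq_pow, h2, Fintype.card_fin]

end Clocks

-- Every discoverer supports `b` at time `t`, so contributes a factor `r`; all other factors are at
-- most `1`. On `fastClock`, where `N * J` steps may not reach time `t`, the trivial bound `1` is
-- used.
open Classical in
lemma weight_evolveUntil_le [NeZero N] {b : Fin K} {r : ℝ} (hr0 : 0 < r) (hr1 : r ≤ 1) (t : ℝ) (J : ℕ)
    (ω : Sample K N) :
    weight r b (evolveUntil (fun _ => none) ω t (N * J)) ≤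
      (∏ n, if (fun j => ω (n, j)) ∈ (discovery b t : Set (ℕ → TickData K N)) then r else 1) +
        (fastClock t J).indicator 1 ω := by
  by_cases hω : ω ∈ fastClock t J
  · rw [Set.indicator_of_mem hω, Pi.one_apply]
    have : 0 ≤ ∏ n, if (fun j => ω (n, j)) ∈ (discovery b t : Set (ℕ → TickData K N))
        then r else 1 := Finset.prod_nonneg fun n _ => by split_ifs <;> positivity
    linarith [weight_le_one (b := b) (evolveUntil (fun _ => none) ω t (N * J)) hr0 hr1]
  · rw [Set.indicator_of_notMem hω, add_zero]
    refine Finset.prod_le_prod (fun n _ => by split_ifs <;> positivity) fun n _ => ?_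
    by_cases hn : (fun j => ω (n, j)) ∈ (discovery b t : Set (ℕ → TickData K N))
    · rw [if_pos hn, if_pos]
      obtain ⟨⟨h0, h1⟩, hd⟩ := hn
      refine evolveUntil_of_discovers (N * J) _ ω t (fun _ => J) ?_ (by simp) rfl ?_ ?_ hd
      · intro n'
        by_contra! h
        exact hω ⟨n', h⟩
      · rwa [tickTime_zero]
      · simpa [tickTime, Finset.sum_range_succ] using h1
    · rw [if_neg hn]
      split_ifs
      · exact hr1
      · exact le_rfl

/-! ### Assembling the quantitative bound. -/

section Bound

variable [NeZero K] [NeZero N] {lam : ℝ} [hlam : Fact (0 < lam)] {μ : I} {p : Fin K → I}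
  {b : Fin K} {s : ℝ}

/-- The failure probability, started from no preferences. -/
theorem one_sub_successProb_none_le (hμ : 0 < μ) (hs : 0 < s) (hsb : s < p b)
    (hp : ∀ k, k ≠ b → p k ≤ s) :
    1 - (successProb lam μ p b (fun _ : Fin N => none)).toReal ≤
      (1 - μ * p b / K * Real.exp (-1) * (1 - s / p b)) ^ N := by
  classical
  have hpb : (0 : ℝ) < p b := hs.trans hsb
  have hr0 : 0 < s / p b := div_pos hs hpb
  have hr1 : s / p b ≤ 1 := (div_le_one hpb).2 hsb.le
  have hlam0 := hlam.out
  -- This maximizes `lam * t * exp (-(lam * t))`, with value `exp (-1)`: the origin of Euler's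
  -- number in the bound.
  set t : ℝ := 1 / lam with ht
  have ht0 : 0 ≤ t := by positivity
  have hlt : lam * t = 1 := by rw [ht]; field_simp
  set v : (Fin N → Memory K) → ℝ := fun m => (successProb lam μ p b m).toReal with hv
  set Q : ℝ≥0∞ := expMeasure lam (Set.Iic t) with hQ
  set g : Sample K N → ℝ := fun ω =>
    ∏ n, if (fun j => ω (n, j)) ∈ (discovery b t : Set (ℕ → TickData K N)) then s / p b else 1
    with hg
  have hgint : Integrable g (law K N lam μ p) := by
    refine Integrable.of_bound (C := 1) ?_ (ae_of_all _ fun ω => ?_)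
    · refine (Finset.measurable_prod _ fun n _ => Measurable.ite ?_ measurable_const
        measurable_const).aestronglyMeasurable
      exact (show Measurable fun (ω : Sample K N) j => ω (n, j) by fun_prop)
        (measurableSet_discovery b t)
    · rw [Real.norm_eq_abs, abs_of_nonneg (Finset.prod_nonneg fun n _ => by
        split_ifs <;> positivity)]
      exact Finset.prod_le_one (fun n _ => by split_ifs <;> positivity) fun n _ => by
        split_ifs <;> simp [hr1]
  -- Optional stopping holds for a bounded number of steps; the truncation error vanishes as `J`
  -- grows.
  have hfinal : ∀ J : ℕ, 1 - v (fun _ => none) ≤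
      (1 - μ * p b / K * Real.exp (-1) * (1 - s / p b)) ^ N + ((N : ℝ≥0∞) * Q ^ (J + 1)).toReal := by
    intro J
    set M : Sample K N → (Fin N → Memory K) := fun ω =>
      evolveUntil (fun _ => none) ω t (N * J) with hM
    have hMm : Measurable M :=
      (measurable_evolveUntil (N * J) _).comp measurable_prodMk_left
    have hMint : ∀ f : (Fin N → Memory K) → ℝ, Integrable (fun ω => f (M ω)) (law K N lam μ p) := by
      intro f
      have : IsProbabilityMeasure ((law K N lam μ p).map M) :=
        Measure.isProbabilityMeasure_map hMm.aemeasurable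
      exact Integrable.comp_measurable (Integrable.of_finite (f := f)) hMm
    have hstopped : ∫ ω, v (M ω) ∂law K N lam μ p = v fun _ => none := by
      rw [integral_toReal (f := fun ω => successProb lam μ p b (M ω))
        ((Measurable.of_discrete (f := successProb lam μ p b)).comp hMm).aemeasurable (ae_of_all _ fun ω => measure_lt_top _ _),
        lintegral_successProb_evolveUntil]
    have hFm : MeasurableSet (fastClock t J : Set (Sample K N)) := measurableSet_fastClock t J
    have hIint : Integrable ((fastClock t J).indicator (1 : Sample K N → ℝ)) (law K N lam μ p) :=
      (integrable_const (1 : ℝ)).indicator hFm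
    calc 1 - v (fun _ => none) = ∫ ω, (1 - v (M ω)) ∂law K N lam μ p := by
          rw [integral_sub (integrable_const _) (hMint v), hstopped]; simp
      _ ≤ ∫ ω, (g ω + (fastClock t J).indicator 1 ω) ∂law K N lam μ p := by
          refine integral_mono (hMint fun m => 1 - v m) (hgint.add hIint) fun ω => ?_
          exact (one_sub_successProb_le_weight hμ hs hsb hp (M ω)).trans
            (weight_evolveUntil_le hr0 hr1 t J ω)
      _ = (1 - μ * p b / K * Real.exp (-1) * (1 - s / p b)) ^ N +
          (law K N lam μ p).real (fastClock t J) := by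
          rw [integral_add hgint hIint, integral_prod_discovery b ht0, hlt, one_mul,
            integral_indicator_one hFm]
      _ ≤ _ := by
          refine add_le_add_right (ENNReal.toReal_mono ?_ (law_fastClock_le t J)) _
          exact ENNReal.mul_ne_top (ENNReal.natCast_ne_top N)
            (ENNReal.pow_ne_top (measure_ne_top _ _))
  have hlim : Tendsto (fun J : ℕ => (1 - (μ : ℝ) * p b / K * Real.exp (-1) * (1 - s / p b)) ^ N +
      ((N : ℝ≥0∞) * Q ^ (J + 1)).toReal) atTop
      (𝓝 ((1 - (μ : ℝ) * p b / K * Real.exp (-1) * (1 - s / p b)) ^ N + 0)) := by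
    refine tendsto_const_nhds.add ?_
    have h1 := (tendsto_add_atTop_iff_nat 1).2
      (ENNReal.tendsto_pow_atTop_nhds_zero_of_lt_one (expMeasure_Iic_lt_one (lam := lam) ht0))
    have h2 := ENNReal.Tendsto.const_mul h1 (Or.inr (ENNReal.natCast_ne_top N))
    have h3 := (ENNReal.tendsto_toReal (a := (N : ℝ≥0∞) * 0) (by simp)).comp h2
    rw [mul_zero, ENNReal.toReal_zero] at h3
    exact h3
  rw [add_zero] at hlim
  exact ge_of_tendsto' hlim hfinal

/-- If `1 - r ≥ δ ^ 2 / 2`, the second term alone suffices. Otherwise `r ≥ 1 - δ ^ 2 / 2 ≥ 1 - δ`,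
and `log r ≥ 1 - 1 / r` gives `(1 - δ) * log r ≥ -(1 - r)`, so the first term suffices. -/
lemma exp_neg_mul_le {r a δ : ℝ} (hr0 : 0 < r) (hr1 : r ≤ 1) (ha : 0 ≤ a) (hδ0 : 0 ≤ δ)
    (hδ1 : δ ≤ 1) :
    Real.exp (-(a * (1 - r))) ≤ r ^ ((1 - δ) * a) + Real.exp (-(a * (δ ^ 2 / 2))) := by
  have hpow : 0 ≤ r ^ ((1 - δ) * a) := (Real.rpow_pos_of_pos hr0 _).le
  rcases le_total (δ ^ 2 / 2) (1 - r) with h | h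
  · have : Real.exp (-(a * (1 - r))) ≤ Real.exp (-(a * (δ ^ 2 / 2))) :=
      Real.exp_le_exp.2 (neg_le_neg (mul_le_mul_of_nonneg_left h ha))
    linarith
  · have hlog : 1 - r⁻¹ ≤ Real.log r := Real.one_sub_inv_le_log_of_pos hr0
    have hkey : -(1 - r) ≤ (1 - δ) * Real.log r := by
      have h1 : (1 - δ) * (1 - r⁻¹) ≤ (1 - δ) * Real.log r :=
        mul_le_mul_of_nonneg_left hlog (by linarith)
      have h2 : -(1 - r) ≤ (1 - δ) * (1 - r⁻¹) := by
        have h3 : (1 - δ) * (1 - r⁻¹) + (1 - r) = (1 - r) * (r - (1 - δ)) / r := by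
          field_simp
          ring
        have h4 : 0 ≤ (1 - r) * (r - (1 - δ)) / r :=
          div_nonneg (mul_nonneg (by linarith) (by nlinarith)) hr0.le
        linarith
      linarith
    have : Real.exp (-(a * (1 - r))) ≤ r ^ ((1 - δ) * a) := by
      rw [Real.rpow_def_of_pos hr0]
      refine Real.exp_le_exp.2 ?_
      nlinarith [mul_le_mul_of_nonneg_left hkey ha]
    linarith [Real.exp_pos (-(a * (δ ^ 2 / 2)))]

theorem le_law_absorbedAt (hμ : 0 < μ) (hs : 0 < s) (hsb : s < p b)
    (hp : ∀ k, k ≠ b → p k ≤ s) {δ : ℝ} (hδ0 : 0 ≤ δ) (hδ1 : δ ≤ 1) :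
    1 - ((p b : ℝ) / s) ^ (-((1 - δ) * ((μ : ℝ) * p b / (K * Real.exp 1)) * N)) -
        Real.exp (-((μ : ℝ) * p b / (K * Real.exp 1) * (δ ^ 2 / 2) * N)) ≤
      (law K N lam μ p).real (absorbedAt N b) := by
  have hpb : (0 : ℝ) < p b := hs.trans hsb
  have hr0 : 0 < s / p b := div_pos hs hpb
  have hr1 : s / p b ≤ 1 := (div_le_one hpb).2 hsb.le
  have hsub : (successProb lam μ p b (fun _ : Fin N => none)).toReal ≤
      (law K N lam μ p).real (absorbedAt N b) := by
    refine ENNReal.toReal_mono (measure_ne_top _ _) (measure_mono_ae ?_)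
    filter_upwards [ae_gap_nonneg_law, ae_exists_lt_gap] with ω h1 h2 hω
    exact mem_absorbedAt h1 h2 hω
  have h := one_sub_successProb_none_le (N := N) (lam := lam) hμ hs hsb hp
  set a : ℝ := (μ : ℝ) * p b / (K * Real.exp 1) with ha
  have hμ1 := μ.2.1
  have hμ2 := μ.2.2
  have ha0 : 0 ≤ a := by positivity
  have hae : (μ : ℝ) * p b / K * Real.exp (-1) = a := by
    rw [ha, Real.exp_neg, div_mul_eq_div_div, div_eq_mul_inv _ (Real.exp 1)]
  rw [hae] at h
  have ha1 : a ≤ 1 := by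
    have hK : (1 : ℝ) ≤ K := by exact_mod_cast NeZero.one_le
    rw [ha, div_le_one (by positivity)]
    have h1 : (μ : ℝ) * p b ≤ 1 := mul_le_one₀ hμ2 hpb.le (p b).2.2
    have h2 : (1 : ℝ) ≤ Real.exp 1 := Real.one_le_exp zero_le_one
    nlinarith
  -- Nonnegativity of the base is needed to raise `1 - x ≤ exp (-x)` to the power `N`.
  have hbase : 0 ≤ 1 - a * (1 - s / p b) := by nlinarith
  have hexp : (1 - a * (1 - s / p b)) ^ N ≤ Real.exp (-(a * N * (1 - s / p b))) := by
    have h1 : 1 - a * (1 - s / p b) ≤ Real.exp (-(a * (1 - s / p b))) := by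
      linarith [Real.add_one_le_exp (-(a * (1 - s / p b)))]
    calc _ ≤ Real.exp (-(a * (1 - s / p b))) ^ N := pow_le_pow_left₀ hbase h1 N
      _ = _ := by rw [← Real.exp_nat_mul]; ring_nf
  have hsplit := exp_neg_mul_le hr0 hr1 (mul_nonneg ha0 (Nat.cast_nonneg N)) hδ0 hδ1
  have e1 : ((p b : ℝ) / s) ^ (-((1 - δ) * a * N)) = (s / p b) ^ ((1 - δ) * (a * N)) := by
    rw [Real.rpow_neg (div_pos hpb hs).le, ← Real.inv_rpow (div_pos hpb hs).le, inv_div, mul_assoc]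
  have e2 : a * (δ ^ 2 / 2) * N = a * N * (δ ^ 2 / 2) := by ring
  rw [e1, e2]
  linarith

end Bound
end SocialBandit

end

theorem theorem1 (K : ℕ) (hK : 2 ≤ K) (p : Fin K → I) (hp : Antitone p)
    (h12 : p ⟨1, hK⟩ < p ⟨0, by omega⟩) (hp2 : p ⟨1, hK⟩ ≠ 0)
    (μ : I) (hμ : 0 < μ) (lam : ℝ) (hlam : 0 < lam) :
    (∀ (N : ℕ) [NeZero N],
      (∀ δ : ℝ, 0 < δ → δ ≤ 1 →
        1 - ((p ⟨0, by omega⟩ : ℝ) / (p ⟨1, hK⟩ : ℝ)) ^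
              (-((1 - δ) * ((μ : ℝ) * (p ⟨0, by omega⟩ : ℝ) / (K * Real.exp 1)) * N))
          - Real.exp (-((μ : ℝ) * (p ⟨0, by omega⟩ : ℝ) / (K * Real.exp 1) * (δ ^ 2 / 2) * N))
        ≤ (SocialBandit.law K N lam μ p).real (SocialBandit.absorbedAt N ⟨0, by omega⟩)) ∧
      (∀ᵐ ω ∂SocialBandit.law K N lam μ p,
        ω ∈ SocialBandit.absorbedAt N ⟨0, by omega⟩ →
          ω ∈ SocialBandit.everyoneLearns N ⟨0, by omega⟩)) ∧
    ∃ C c : ℝ, 0 < C ∧ 0 < c ∧ ∀ (N : ℕ) [NeZero N],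
      1 - C * Real.exp (-(c * N)) ≤
        (SocialBandit.law K N lam μ p).real
          (SocialBandit.everyoneLearns N ⟨0, by omega⟩) := by
  have : NeZero K := ⟨by omega⟩
  have : Fact (0 < lam) := ⟨hlam⟩
  set b : Fin K := ⟨0, by omega⟩ with hb
  set s : ℝ := (p ⟨1, hK⟩ : ℝ) with hsdef
  have hs : 0 < s := lt_of_le_of_ne (p _).2.1 fun h => hp2 (Subtype.ext h.symm)
  have hsb : s < p b := h12
  have hps : ∀ k, k ≠ b → (p k : ℝ) ≤ s := by
    intro k hk
    refine hp (show (⟨1, hK⟩ : Fin K) ≤ k from ?_)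
    have : k.val ≠ 0 := fun h => hk (Fin.ext h)
    exact Fin.mk_le_of_le_val (by omega)
  have hpb : (0 : ℝ) < p b := hs.trans hsb
  have hμ0 : (0 : ℝ) < μ := hμ
  have hbound : ∀ (N : ℕ) [NeZero N] (δ : ℝ), 0 < δ → δ ≤ 1 →
      1 - ((p b : ℝ) / s) ^ (-((1 - δ) * ((μ : ℝ) * p b / (K * Real.exp 1)) * N)) -
        Real.exp (-((μ : ℝ) * p b / (K * Real.exp 1) * (δ ^ 2 / 2) * N)) ≤
      (SocialBandit.law K N lam μ p).real (SocialBandit.absorbedAt N b) :=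
    fun N _ δ hδ0 hδ1 => SocialBandit.le_law_absorbedAt hμ hs hsb hps hδ0.le hδ1
  refine ⟨fun N _ => ⟨hbound N, ae_of_all _ fun ω hω =>
    SocialBandit.absorbedAt_subset_everyoneLearns b hω⟩, ?_⟩
  set a : ℝ := (μ : ℝ) * p b / (K * Real.exp 1) with ha
  have hK0 : (0 : ℝ) < K := by exact_mod_cast (show 0 < K by omega)
  have ha0 : 0 < a := by positivity
  have hR : 1 < (p b : ℝ) / s := (one_lt_div hs).2 hsb
  have hL : 0 < Real.log ((p b : ℝ) / s) := Real.log_pos hR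
  -- The rates of the two error terms at `δ = 1 / 2`, where `1 - δ = 1 / 2` and `δ ^ 2 / 2 = 1 / 8`;
  -- the factor `2` counts the terms.
  refine ⟨2, min (Real.log ((p b : ℝ) / s) * (a / 2)) (a / 8), two_pos,
    lt_min (by positivity) (by positivity), fun N _ => ?_⟩
  have h1 := hbound N (1 / 2) (by norm_num) (by norm_num)
  have h2 : (SocialBandit.law K N lam μ p).real (SocialBandit.absorbedAt N b) ≤
      (SocialBandit.law K N lam μ p).real (SocialBandit.everyoneLearns N b) :=
    measureReal_mono (SocialBandit.absorbedAt_subset_everyoneLearns b)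
  set c : ℝ := min (Real.log ((p b : ℝ) / s) * (a / 2)) (a / 8) with hc
  have hN : (0 : ℝ) ≤ N := Nat.cast_nonneg N
  have h3 : ((p b : ℝ) / s) ^ (-((1 - 1 / 2) * a * N)) ≤ Real.exp (-(c * N)) := by
    rw [Real.rpow_def_of_pos (by linarith)]
    refine Real.exp_le_exp.2 ?_
    have := mul_le_mul_of_nonneg_right (min_le_left (Real.log ((p b : ℝ) / s) * (a / 2)) (a / 8)) hN
    rw [← hc] at this
    linarith
  have h4 : Real.exp (-(a * ((1 / 2) ^ 2 / 2) * N)) ≤ Real.exp (-(c * N)) := by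
    refine Real.exp_le_exp.2 ?_
    have := mul_le_mul_of_nonneg_right (min_le_right (Real.log ((p b : ℝ) / s) * (a / 2)) (a / 8)) hN
    rw [← hc] at this
    linarith
  linarith
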